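/- A fair division instance consists of $n$ agents $[n]$, $m$ indivisible items $[m]$ and additive valuations $v_a(S)=\sum_{g\in S}v_a(g)$ with $0\le v_a(g)\le 1$ for all agents $a$ and items $g$. Put $\mathsf{PROP}_a=v_a([m])/n$, and let $\log$ be the logarithm to base $2$. Consider the following algorithm BoundedProp for an arrival order $\tau=\langle\tau_1,\dots,\tau_n\rangle$ of the agents. A stage with remaining agents $a_1,\dots,a_r$ (in the order of arrival) and remaining items $U$ is as follows. If $r=1$, then $a_1$ receives $U$. If $r\ge 2$, let $\mathrm{mid}=\lfloor r/2\rfloor$. Run Round-Robin on $U$: the agents $a_1,\dots,a_r$ cyclically take their most preferred remaining item (among equally preferred items the one of smallest index) until all items are taken. Let $M[p]$ be the set of items taken by $a_p$ and $M[j,p]$ the $j$-th item taken by $a_p$. Then $a_1,\dots,a_{\mathrm{mid}}$ arrive in this order. Let $D$ be the set of the items $M[j,p]$ with $j\in\{1,2\}$, $p>\mathrm{mid}$ and $M[p]$ unpicked that are still in $M[p]$. When $a_i$ arrives: * if $i=\mathrm{mid}$, all items of $D$ are moved to $M[i]$, and the unpicked parts are presented to $a_i$; * if $i<\mathrm{mid}$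 and $v_{a_i}(g)>0$ for some $g\in D$, one such $g$ (the one of smallest index) is moved to $M[i]$, and the unpicked parts are presented to $a_i$; * otherwise a temporary partition $M'$ is presented (again only its unpicked parts), which arises from $M$ by swapping $M[1,i+k]$ with $M[1,\mathrm{mid}+k]$ for all $1\le k\le\mathrm{mid}-i$ for which $M[i+k]$ and $M[\mathrm{mid}+k]$ are unpicked (if one of the two items is no longer in its part, only the other one moves). After the pick, $M$ is restored, unless the part picked differs from its counterpart in $M$, in which case $M'$ is kept. If $M[i]$ has already been picked by another agent, the unpicked parts are presented to $a_i$ unchanged. Each agent picks one of the presented parts and departs with it. After the arrival of $a_{\mathrm{mid}}$, the items of the unpicked parts are pooled, and the next stage runs with the agents $a_{\mathrm{mid}+1},\dots,a_r$ and these items. The first stage has the agents $\tau_1,\dots,\tau_n$ and the items $[m]$. Agents pick rationally if each picks a part of highest value for them among the presented ones, ties being broken arbitrarily. **Theorem.** There is an algorithm that, for every fair division instance, computes in time polynomial in $n+m$ an arrival order $\tau$ with the following properties. (The algorithm is a program of a random access machine that adds, subtracts and compares indices and values at unit cost.) 1. $\tau$ is greedy: for every $i\in[n]$, if some agent $a\notin\{\tau_1,\dots,\tau_{i-1}\}$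 has $\mathsf{PROP}_a\ge 2(\lceil\log i\rceil+1)$, then $\tau_i$ is such an agent. 2. When BoundedProp is run with the arrival order $\tau$ and all agents pick rationally, then for every $i\in[n]$ the agent $\tau_i$ receives a part of value at least $\mathsf{PROP}_{\tau_i}-2\lceil\log i\rceil-2$, however the agents break ties. -/

import Mathlib

noncomputable section

/-! ### Fair division instances -/

/-- A fair division instance with `n` agents and `m` indivisible items: additive valuations,
given by the values of the single items, normalized so that every item has value in `[0, 1]`. -/
structure FairInstance (n m : ℕ) where
  val : Fin n → Fin m → ℝ
  nonneg : ∀ a g, 0 ≤ val a g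
  le_one : ∀ a g, val a g ≤ 1

/-- A labelled family of parts; the labels are the agents. -/
abbrev Parts (n m : ℕ) : Type := Fin n → Finset (Fin m)

/-- A choice behaviour of the agents: `c a avail P` is the label of the part that agent `a` picks
when shown the parts `P q` with `q ∈ avail`. -/
abbrev Choice (n m : ℕ) : Type := Fin n → Finset (Fin n) → Parts n m → Fin n

namespace FairInstance

variable {n m : ℕ} (I : FairInstance n m)

/-- The (additive) value of a set of items. -/
def value (a : Fin n) (S : Finset (Fin m)) : ℝ := ∑ g ∈ S, I.val a g

/-- The proportional share `v_a([m]) / n`. -/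
def prop (a : Fin n) : ℝ := I.value a Finset.univ / n

/-- All agents pick rationally: from every nonempty menu, each agent picks one of the presented
parts, and one of highest value for them. Ties are broken in any way whatsoever. -/
def IsRational (c : Choice n m) : Prop :=
  ∀ (a : Fin n) (avail : Finset (Fin n)) (P : Parts n m), avail.Nonempty →
    c a avail P ∈ avail ∧ ∀ q ∈ avail, I.value a (P q) ≤ I.value a (P (c a avail P))

/-! ### Round-Robin -/

/-- The most preferred item of agent `a` in `U`, the one of smallest index among equally
preferred ones; `none` if `U` is empty. -/
def topItem (a : Fin n) (U : Finset (Fin m)) : Option (Fin m) :=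
  ((U.filter fun g => ∀ h ∈ U, I.val a h ≤ I.val a g).sort (· ≤ ·)).head?

/-- The agents of the list take turns; each takes their most preferred remaining item, until no
item remains. The result is the list of the picks in the order in which they are made. -/
def serialPicks : List (Fin n) → Finset (Fin m) → List (Fin n × Fin m)
  | [], _ => []
  | a :: as, U =>
    match I.topItem a U with
    | none => []
    | some g => (a, g) :: serialPicks as (U.erase g)

/-- Round-Robin on the items `U` with the cyclic picking sequence `L`, viewed as a matrix: the
entry of row `r` in column `a` is the `r`-th pick (counted from `0`) of agent `a`. One has at most
`U.card` rounds. -/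
def roundRobin (L : List (Fin n)) (U : Finset (Fin m)) (a : Fin n) : List (Fin m) :=
  ((I.serialPicks (List.replicate U.card L).flatten U).filter (fun x => x.1 = a)).map Prod.snd

/-! ### The algorithm for bounded proportional shares -/

end FairInstance

namespace BoundedProp

variable {n m : ℕ}

/-- The entry in row `j` (counted from `0`) of column `a` of the matrix `R`, as a set with at most
one element: it is empty (the entry is `⊥`) if there is no such entry or if the item has been
removed from the part `P a`. -/
def cell (R : Fin n → List (Fin m)) (P : Parts n m) (j : ℕ) (a : Fin n) : Finset (Fin m) :=
  (R a)[j]?.toFinset ∩ P a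

/-- The items in the top two rows of the unpicked donor parts. -/
def donorItems (R : Fin n → List (Fin m)) (P : Parts n m) (avail : Finset (Fin n))
    (donors : List (Fin n)) : Finset (Fin m) :=
  (donors.toFinset ∩ avail).biUnion fun d => cell R P 0 d ∪ cell R P 1 d

/-- Move the items of `S` to the part labelled `a`. -/
def transfer (P : Parts n m) (S : Finset (Fin m)) (a : Fin n) : Parts n m :=
  fun q => if q = a then P q ∪ S else P q \ S

/-- Swap the top entries of the columns `b` and `d`. If one of the entries is `⊥`, then the other
one just moves. -/
def swapTop (R : Fin n → List (Fin m)) (P : Parts n m) (b d : Fin n) : Parts n m :=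
  transfer (transfer P (cell R P 0 b) d) (cell R P 0 d) b

/-- The temporary partition: the top entries of the columns in each of the given (disjoint) pairs
are swapped. Parts that have been picked already are left alone. -/
def rebundle (R : Fin n → List (Fin m)) (P : Parts n m) (avail : Finset (Fin n))
    (pairs : List (Fin n × Fin n)) : Parts n m :=
  (pairs.filter fun x => x.1 ∈ avail ∧ x.2 ∈ avail).foldl (fun Q x => swapTop R Q x.1 x.2) P

/-- The state of a stage: the current parts, the labels of the unpicked parts, and the parts that
the agents have received so far. -/
structure StageState (n m : ℕ) where
  parts : Parts n m
  avail : Finset (Fin n)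
  got : Parts n m

/-- Agent `a` is shown the unpicked parts of `P` and takes one of them. Afterwards the parts
that remain are those of `next q`, where `q` is the label of the part taken. -/
def present (c : Choice n m) (a : Fin n) (P : Parts n m) (next : Fin n → Parts n m)
    (s : StageState n m) : StageState n m where
  parts := next (c a s.avail P)
  avail := s.avail.erase (c a s.avail P)
  got := Function.update s.got a (P (c a s.avail P))

/-- The arrival of agent `a` in a stage with Round-Robin matrix `R`. Here `later` lists the agents
of the stage that arrive after `a`, and `donors` lists the agents left to the next stages.

* If `a` is the last agent of the stage, then all items left in the top two rows of the donors are
  added to the part of `a`.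
* Otherwise, if `a` values one of these items positively, then such an item is moved to the part
  of `a`.
* Otherwise a temporary partition is presented, in which the top items of the `k`-th later agent
  and of the `k`-th donor are swapped for all `k`.

The temporary partition is discarded after the pick; only if the part taken was affected by the
swaps (so that the old partition is no longer there) it is kept. If the part of `a` has been
taken by an earlier agent, then the unpicked parts are presented unchanged. -/
def arrive (I : FairInstance n m) (c : Choice n m) (R : Fin n → List (Fin m))
    (donors later : List (Fin n)) (a : Fin n) (s : StageState n m) : StageState n m :=
  let D := donorItems R s.parts s.avail donors
  let Dpos := D.filter fun g => 0 < I.val a g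
  if a ∉ s.avail then
    present c a s.parts (fun _ => s.parts) s
  else if later = [] then
    let P := transfer s.parts D a
    present c a P (fun _ => P) s
  else if h : Dpos.Nonempty then
    let P := transfer s.parts {Dpos.min' h} a
    present c a P (fun _ => P) s
  else
    let P := rebundle R s.parts s.avail (later.zip donors)
    present c a P (fun q => if P q = s.parts q then s.parts else P) s

/-- The picking phase of a stage: the agents of the list arrive one after the other. -/
def picking (I : FairInstance n m) (c : Choice n m) (R : Fin n → List (Fin m))
    (donors : List (Fin n)) : List (Fin n) → StageState n m → StageState n m
  | [], s => s
  | a :: later, s => picking I c R donors later (arrive I c R donors later a s)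

/-- The recursive algorithm for the agents `L` (in the order of their arrival) and the items `U`,
when the agents that have arrived before have received the parts `got`. In a stage the first half
of the agents (rounded down) pick; then the items of the unpicked parts are pooled. -/
def run (I : FairInstance n m) (c : Choice n m) (L : List (Fin n)) (U : Finset (Fin m))
    (got : Parts n m) : Parts n m :=
  match L with
  | [] => got
  | [a] => Function.update got a U
  | a :: b :: L' =>
    let L := a :: b :: L'
    let mid := L.length / 2
    let R := I.roundRobin L U
    let s := picking I c R (L.drop mid) (L.take mid)
      { parts := fun q => (R q).toFinset, avail := L.toFinset, got := got }
    run I c (L.drop mid) (s.avail.biUnion s.parts) s.got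
  termination_by L.length
  decreasing_by
    simp only [List.length_drop, List.length_cons]
    omega

end BoundedProp

namespace FairInstance

variable {n m : ℕ} (I : FairInstance n m)

/-- The part that each agent receives when the algorithm is run with the arrival order
`τ 0, τ 1, …, τ (n - 1)` and the agents pick according to `c`. -/
def boundedProp (τ : Equiv.Perm (Fin n)) (c : Choice n m) : Parts n m :=
  BoundedProp.run I c (List.ofFn τ) Finset.univ (fun _ => ∅)

/-- `⌈log₂ i⌉` for the `i`-th position, where the position `i = k + 1` is given by `k : Fin n`. -/
def logPos (k : Fin n) : ℤ := ⌈Real.logb 2 ((k : ℝ) + 1)⌉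

/-- `τ` is a greedy arrival order: the positions are filled one after the other, and position `i`
goes to an agent `a` with `PROP_a ≥ 2 (⌈log i⌉ + 1)` whenever some agent without an earlier
position is of this kind. -/
def IsGreedyOrder (τ : Equiv.Perm (Fin n)) : Prop :=
  ∀ k l : Fin n, k ≤ l →
    2 * ((logPos k : ℝ) + 1) ≤ I.prop (τ l) → 2 * ((logPos k : ℝ) + 1) ≤ I.prop (τ k)

end FairInstance

/-! ### A machine model with a step count

A random access machine with registers and an unbounded memory for natural numbers (indices) and
likewise for real numbers (values). Its instructions on numbers are constants, addition,
subtraction (truncated for indices) and comparison, at unit cost; there is no multiplication,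
division or rounding. After `t` steps every value is thus an integer combination of the input
values and of a constant, with coefficients of `O(t)` bits, so that a polynomial number of steps
is also polynomial time in the bit model if the input values are rational. -/

namespace RAM

/-- Programs. The arguments are numbers of registers, except for the constants `k`. -/
inductive Prog : Type
  /-- index register `d` becomes the constant `k` -/
  | setI (d k : ℕ)
  /-- index register `d` becomes the sum of the index registers `x` and `y` -/
  | addI (d x y : ℕ)
  /-- index register `d` becomes the truncated difference of the index registers `x` and `y` -/
  | subI (d x y : ℕ)
  /-- index register `d` becomes the content of the index memory at the address in `x` -/
  | loadI (d x : ℕ)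
  /-- the index memory at the address in `x` becomes the content of the index register `y` -/
  | storeI (x y : ℕ)
  /-- value register `d` becomes the constant `k` -/
  | setV (d k : ℕ)
  /-- value register `d` becomes the sum of the value registers `x` and `y` -/
  | addV (d x y : ℕ)
  /-- value register `d` becomes the difference of the value registers `x` and `y` -/
  | subV (d x y : ℕ)
  /-- value register `d` becomes the content of the value memory at the address in `x` -/
  | loadV (d x : ℕ)
  /-- the value memory at the address in `x` becomes the content of the value register `y` -/
  | storeV (x y : ℕ)
  /-- value register `d` becomes the input entry at the indices in the registers `x` and `y` -/
  | input (d x y : ℕ)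
  /-- first `p`, then `q` -/
  | seq (p q : Prog)
  /-- `p` if index register `x` is less than index register `y`, otherwise `q` -/
  | ifI (x y : ℕ) (p q : Prog)
  /-- `p` if value register `x` is less than value register `y`, otherwise `q` -/
  | ifV (x y : ℕ) (p q : Prog)
  /-- repeat `p` while index register `x` is less than index register `y` -/
  | whileI (x y : ℕ) (p : Prog)

/-- The state of the machine. -/
structure State where
  idx : ℕ → ℕ
  mem : ℕ → ℕ
  val : ℕ → ℝ
  vmem : ℕ → ℝ

open Function in
/-- `Exec inp p s t s'`: started in state `s` with the read-only input table `inp`, the program `p`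
halts in state `s'` after exactly `t` steps. -/
inductive Exec (inp : ℕ → ℕ → ℝ) : Prog → State → ℕ → State → Prop
  | setI (d k s) : Exec inp (.setI d k) s 1 { s with idx := update s.idx d k }
  | addI (d x y s) : Exec inp (.addI d x y) s 1
      { s with idx := update s.idx d (s.idx x + s.idx y) }
  | subI (d x y s) : Exec inp (.subI d x y) s 1
      { s with idx := update s.idx d (s.idx x - s.idx y) }
  | loadI (d x s) : Exec inp (.loadI d x) s 1
      { s with idx := update s.idx d (s.mem (s.idx x)) }
  | storeI (x y s) : Exec inp (.storeI x y) s 1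
      { s with mem := update s.mem (s.idx x) (s.idx y) }
  | setV (d k s) : Exec inp (.setV d k) s 1 { s with val := update s.val d (k : ℝ) }
  | addV (d x y s) : Exec inp (.addV d x y) s 1
      { s with val := update s.val d (s.val x + s.val y) }
  | subV (d x y s) : Exec inp (.subV d x y) s 1
      { s with val := update s.val d (s.val x - s.val y) }
  | loadV (d x s) : Exec inp (.loadV d x) s 1
      { s with val := update s.val d (s.vmem (s.idx x)) }
  | storeV (x y s) : Exec inp (.storeV x y) s 1
      { s with vmem := update s.vmem (s.idx x) (s.val y) }
  | input (d x y s) : Exec inp (.input d x y) s 1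
      { s with val := update s.val d (inp (s.idx x) (s.idx y)) }
  | seq {p q s t s' t' s''} : Exec inp p s t s' → Exec inp q s' t' s'' →
      Exec inp (.seq p q) s (t + t') s''
  | ifI_lt {x y p q s t s'} : s.idx x < s.idx y → Exec inp p s t s' →
      Exec inp (.ifI x y p q) s (t + 1) s'
  | ifI_ge {x y p q s t s'} : s.idx y ≤ s.idx x → Exec inp q s t s' →
      Exec inp (.ifI x y p q) s (t + 1) s'
  | ifV_lt {x y p q s t s'} : s.val x < s.val y → Exec inp p s t s' →
      Exec inp (.ifV x y p q) s (t + 1) s'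
  | ifV_ge {x y p q s t s'} : s.val y ≤ s.val x → Exec inp q s t s' →
      Exec inp (.ifV x y p q) s (t + 1) s'
  | while_lt {x y p s t s' t' s''} : s.idx x < s.idx y → Exec inp p s t s' →
      Exec inp (.whileI x y p) s' t' s'' → Exec inp (.whileI x y p) s (t + t' + 1) s''
  | while_ge {x y p s} : s.idx y ≤ s.idx x → Exec inp (.whileI x y p) s 1 s

/-- The initial state: `n` and `m` are in the index registers `0` and `1`; all else is `0`. -/
def start (n m : ℕ) : State where
  idx := fun r => if r = 0 then n else if r = 1 then m else 0
  mem := fun _ => 0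
  val := fun _ => 0
  vmem := fun _ => 0

/-- The values of the items for the agents as an input table, padded by `0`. -/
def table {n m : ℕ} (I : FairInstance n m) (a g : ℕ) : ℝ :=
  if h : a < n ∧ g < m then I.val ⟨a, h.1⟩ ⟨g, h.2⟩ else 0

/-- On the instance `I`, the program `p` halts after at most `T` steps with the arrival order
`τ 0, …, τ (n - 1)` in the first `n` cells of the index memory. -/
def ComputesOrder {n m : ℕ} (p : Prog) (I : FairInstance n m) (τ : Equiv.Perm (Fin n))
    (T : ℕ) : Prop :=
  ∃ t s, Exec (table I) p (start n m) t s ∧ t ≤ T ∧ ∀ k : Fin n, s.mem k = τ k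

end RAM

end

/-! Take the agents in order of decreasing proportional share; this order is greedy, and a machine
finds it by counting, for each agent, those with a larger total value. The guarantee for an
arbitrary greedy order (`IsGreedyOrder.le_value`) rests on comparing every stage with the matrix of
the very first Round-Robin.

Call an agent good in a stage if the first two picks of their column have positive value. Each
presentation is designed so that a good agent, finding all earlier agents gone with their own
columns, strictly prefers the own part to all others (`choice_last`, `choice_donated`,
`choice_rebundle`). Ties then play no role, and the agent leaves with at least the own column. If
all agents of the first half are good, the donors are left with exactly their columns below the top
two rows (`picking_parts`). These remaining picks still form a valid cyclic picking sequence of the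
donors, so Round-Robin in the next stage reproduces the old matrix without those rows
(`serialPicks_cyclic`, `laterPicks_fst_prefix`).

Hence an agent loses at most two items, of value at most 2, in each stage spent among the donors.
Halving bounds the number of these stages by ⌈log i⌉ (`depth_le_logPos`). Round-Robin gives
everybody more than PROP − 1 initially (`value_column_gt`), so an agent with PROP ≥ 2(⌈log i⌉ + 1)
still has a column of value above 1 when it matters; as items are worth at most 1, the agent is good
(`hasTwoPositive_of_one_lt`). If agent i has such a large share, greediness makes all earlier agents
good as well; otherwise the claimed bound is negative. -/

noncomputable section

/-! ### Picking sequences. -/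

namespace FairInstance

variable {n m : ℕ} (I : FairInstance n m)

/-- Agent `a` picks `g` rather than `h`: they prefer `g`, or they are indifferent and `g` has the
smaller index. -/
def Prefers (a : Fin n) (g h : Fin m) : Prop :=
  I.val a h < I.val a g ∨ I.val a h = I.val a g ∧ g < h

variable {I} in
theorem Prefers.le {a : Fin n} {g h : Fin m} (H : I.Prefers a g h) : I.val a h ≤ I.val a g := by
  rcases H with H | H
  · exact H.le
  · exact H.1.le

variable {I} in
theorem Prefers.ne {a : Fin n} {g h : Fin m} (H : I.Prefers a g h) : g ≠ h := by
  rintro rfl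
  rcases H with H | H
  · exact lt_irrefl _ H
  · exact lt_irrefl _ H.2

variable {I} in
theorem Prefers.asymm {a : Fin n} {g h : Fin m} (H : I.Prefers a g h) : ¬ I.Prefers a h g := by
  rintro (H' | H')
  · exact absurd H.le (not_le.2 H')
  · rcases H with H | H
    · exact absurd H'.1 (ne_of_gt H)
    · exact lt_asymm H.2 H'.2

theorem topItem_spec {a : Fin n} {U : Finset (Fin m)} {g : Fin m} (h : I.topItem a U = some g) :
    g ∈ U ∧ ∀ x ∈ U, x ≠ g → I.Prefers a g x := by
  unfold topItem at h
  set F := U.filter fun g => ∀ h ∈ U, I.val a h ≤ I.val a g with hF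
  obtain ⟨t, ht⟩ := List.head?_eq_some_iff.1 h
  have hg : g ∈ F := by
    rw [← Finset.mem_sort (· ≤ ·), ht]
    simp
  have hsorted : (F.sort (· ≤ ·)).Pairwise (· ≤ ·) := Finset.pairwise_sort F (· ≤ ·)
  rw [ht, List.pairwise_cons] at hsorted
  have hg' := (Finset.mem_filter.1 hg)
  refine ⟨hg'.1, fun x hx hxg => ?_⟩
  rcases (hg'.2 x hx).lt_or_eq with hlt | heq
  · exact Or.inl hlt
  · refine Or.inr ⟨heq, ?_⟩
    have hxF : x ∈ F := Finset.mem_filter.2 ⟨hx, fun y hy => heq ▸ hg'.2 y hy⟩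
    rw [← Finset.mem_sort (· ≤ ·), ht, List.mem_cons] at hxF
    exact lt_of_le_of_ne (hsorted.1 x (hxF.resolve_left hxg)) (Ne.symm hxg)

theorem exists_topItem (a : Fin n) {U : Finset (Fin m)} (hU : U.Nonempty) :
    ∃ g, I.topItem a U = some g := by
  unfold topItem
  obtain ⟨g, hg, hmax⟩ := U.exists_max_image (I.val a) hU
  have hne : (U.filter fun g => ∀ h ∈ U, I.val a h ≤ I.val a g).Nonempty :=
    ⟨g, Finset.mem_filter.2 ⟨hg, hmax⟩⟩
  cases hs : (U.filter fun g => ∀ h ∈ U, I.val a h ≤ I.val a g).sort (· ≤ ·) with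
  | nil =>
    obtain ⟨x, hx⟩ := hne
    rw [← Finset.mem_sort (· ≤ ·), hs] at hx
    simp at hx
  | cons x t => exact ⟨x, rfl⟩

theorem topItem_eq_some {a : Fin n} {U : Finset (Fin m)} {g : Fin m} (hg : g ∈ U)
    (h : ∀ x ∈ U, x ≠ g → I.Prefers a g x) : I.topItem a U = some g := by
  obtain ⟨g', hg'⟩ := I.exists_topItem a ⟨g, hg⟩
  rw [hg']
  by_contra hne
  have hne' : g' ≠ g := fun e => hne (by rw [e])
  have := I.topItem_spec hg'
  exact (h g' this.1 hne').asymm (this.2 g hg hne'.symm)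

/-- The order between the picks of a picking sequence: whoever picks earlier prefers the own item
to all items that are picked later. -/
def PickOrder (x y : Fin n × Fin m) : Prop := I.Prefers x.1 x.2 y.2

/-- Nobody passes while items remain, so turns are lost only at the end. This property and
`serialPicks_pairwise` characterize the outcome by `serialPicks_eq`; later arguments therefore use
arbitrary lists of picks with these two properties. -/
theorem serialPicks_fst_prefix (as : List (Fin n)) (U : Finset (Fin m)) :
    (I.serialPicks as U).map Prod.fst <+: as := by
  induction as generalizing U with
  | nil => simp [serialPicks]
  | cons a as ih =>
    unfold serialPicks
    cases h : I.topItem a U with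
    | none => simp
    | some g => simpa using ih (U.erase g)

theorem mem_of_mem_serialPicks (as : List (Fin n)) (U : Finset (Fin m)) :
    ∀ x ∈ I.serialPicks as U, x.2 ∈ U := by
  induction as generalizing U with
  | nil => simp [serialPicks]
  | cons a as ih =>
    unfold serialPicks
    cases h : I.topItem a U with
    | none => simp
    | some g =>
      intro x hx
      rcases List.mem_cons.1 hx with rfl | hx
      · exact (I.topItem_spec h).1
      · exact Finset.mem_of_mem_erase (ih _ x hx)

theorem serialPicks_pairwise (as : List (Fin n)) (U : Finset (Fin m)) :
    (I.serialPicks as U).Pairwise I.PickOrder := by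
  induction as generalizing U with
  | nil => simp [serialPicks]
  | cons a as ih =>
    unfold serialPicks
    cases h : I.topItem a U with
    | none => simp
    | some g =>
      refine List.pairwise_cons.2 ⟨fun x hx => ?_, ih _⟩
      have := Finset.mem_erase.1 (I.mem_of_mem_serialPicks _ _ x hx)
      exact (I.topItem_spec h).2 _ this.2 this.1

/-- The set of the items that occur in a list of picks. -/
def pickedItems (l : List (Fin n × Fin m)) : Finset (Fin m) := (l.map Prod.snd).toFinset

theorem mem_pickedItems {l : List (Fin n × Fin m)} {g : Fin m} :
    g ∈ pickedItems l ↔ ∃ a, (a, g) ∈ l := by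
  simp [pickedItems]

theorem pickedItems_serialPicks (as : List (Fin n)) (U : Finset (Fin m))
    (h : U.card ≤ as.length) : pickedItems (I.serialPicks as U) = U := by
  induction as generalizing U with
  | nil =>
    have : U = ∅ := by simpa using h
    simp [serialPicks, pickedItems, this]
  | cons a as ih =>
    unfold serialPicks
    cases hg : I.topItem a U with
    | none =>
      rcases U.eq_empty_or_nonempty with rfl | hne
      · simp [pickedItems]
      · obtain ⟨g, hg'⟩ := I.exists_topItem a hne
        simp [hg'] at hg
    | some g =>
      have hgU := (I.topItem_spec hg).1
      have := ih (U.erase g) (by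
        rw [Finset.card_erase_of_mem hgU]
        simp only [List.length_cons] at h
        omega)
      simp only [pickedItems, List.map_cons, List.toFinset_cons] at this ⊢
      rw [this, Finset.insert_erase hgU]

theorem nodup_snd_of_pairwise {l : List (Fin n × Fin m)} (h : l.Pairwise I.PickOrder) :
    (l.map Prod.snd).Nodup :=
  List.pairwise_map.2 (h.imp fun H => H.ne)

/-- A list of picks in which everyone prefers the own item to the later ones is the outcome of the
picking sequence on its own items. -/
theorem serialPicks_eq {l : List (Fin n × Fin m)} (h : l.Pairwise I.PickOrder) (as : List (Fin n))
    (has : l.map Prod.fst <+: as) : I.serialPicks as (pickedItems l) = l := by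
  induction l generalizing as with
  | nil =>
    cases as with
    | nil => rfl
    | cons a as =>
      have : I.topItem a ∅ = none := by simp [topItem]
      simp [serialPicks, pickedItems, this]
  | cons x l ih =>
    cases as with
    | nil => simp at has
    | cons a as =>
      rw [List.map_cons, List.cons_prefix_cons] at has
      obtain ⟨rfl, has⟩ := has
      have hnd := I.nodup_snd_of_pairwise h
      rw [List.map_cons, List.nodup_cons] at hnd
      rw [List.pairwise_cons] at h
      -- The items are exactly those picked in the list, so the first pick beats every other
      -- available item.
      have htop : I.topItem x.1 (pickedItems (x :: l)) = some x.2 := by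
        refine I.topItem_eq_some (by simp [pickedItems]) fun g hg hne => ?_
        obtain ⟨b, hb⟩ := mem_pickedItems.1 hg
        rcases List.mem_cons.1 hb with e | hb
        · exact absurd (by rw [← e]) hne
        · exact h.1 _ hb
      have her : (pickedItems (x :: l)).erase x.2 = pickedItems l := by
        simp only [pickedItems, List.map_cons, List.toFinset_cons]
        exact Finset.erase_insert (by simpa using hnd.1)
      unfold serialPicks
      rw [htop]
      simp only [her, ih h.2 as has]

/-! ### Columns of the matrix of picks -/

/-- The items picked by `a`, in the order of the picks. -/
def column (l : List (Fin n × Fin m)) (a : Fin n) : List (Fin m) :=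
  (l.filter fun x => x.1 = a).map Prod.snd

theorem mem_column {l : List (Fin n × Fin m)} {a : Fin n} {g : Fin m} :
    g ∈ column l a ↔ (a, g) ∈ l := by
  simp [column]

theorem column_append (l l' : List (Fin n × Fin m)) (a : Fin n) :
    column (l ++ l') a = column l a ++ column l' a := by
  simp [column]

theorem column_nodup {l : List (Fin n × Fin m)} (h : l.Pairwise I.PickOrder) (a : Fin n) :
    (column l a).Nodup :=
  (I.nodup_snd_of_pairwise h).sublist (List.filter_sublist.map _)

theorem column_disjoint {l : List (Fin n × Fin m)} (h : l.Pairwise I.PickOrder) {a b : Fin n}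
    (hab : a ≠ b) : Disjoint (column l a).toFinset (column l b).toFinset := by
  rw [Finset.disjoint_left]
  intro g ha hb
  rw [List.mem_toFinset, mem_column] at ha hb
  have := List.inj_on_of_nodup_map (I.nodup_snd_of_pairwise h) ha hb rfl
  exact hab (congrArg Prod.fst this)

theorem column_of_prefix {l : List (Fin n × Fin m)} {L : List (Fin n)} (hL : L.Nodup)
    (h : l.map Prod.fst <+: L) (p : ℕ) (hp : p < L.length) :
    column l L[p] = (l[p]?.map Prod.snd).toList := by
  induction L generalizing l p with
  | nil => simp at hp
  | cons b L ih =>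
    cases l with
    | nil => simp [column]
    | cons x l =>
      rw [List.map_cons, List.cons_prefix_cons] at h
      obtain ⟨rfl, h⟩ := h
      rw [List.nodup_cons] at hL
      cases p with
      | zero =>
        have : l.filter (fun y => y.1 = x.1) = [] := by
          refine List.filter_eq_nil_iff.2 fun y hy => ?_
          have : y.1 ∈ L := h.subset (List.mem_map_of_mem hy)
          simp only [decide_eq_true_eq]
          exact fun e => hL.1 (e ▸ this)
        simp [column, this]
      | succ p =>
        have hp' : p < L.length := by simpa using hp
        have hne : x.1 ≠ L[p] := fun e => hL.1 (e ▸ List.getElem_mem hp')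
        have := ih hL.2 h p hp'
        simp only [List.getElem_cons_succ, List.getElem?_cons_succ, ← this]
        simp [column, hne]

/-- The truncated `N - 1` is harmless: for `N = 0` there are no picks at all. -/
theorem drop_fst_prefix {l : List (Fin n × Fin m)} {L : List (Fin n)} {N : ℕ}
    (h : l.map Prod.fst <+: (List.replicate N L).flatten) :
    (l.drop L.length).map Prod.fst <+: (List.replicate (N - 1) L).flatten := by
  rw [List.map_drop]
  cases N with
  | zero => simp at h; simp [h]
  | succ N =>
    have := h.drop L.length
    simpa [List.replicate_succ] using this

theorem take_fst_prefix {l : List (Fin n × Fin m)} {L : List (Fin n)} {N : ℕ}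
    (h : l.map Prod.fst <+: (List.replicate N L).flatten) :
    (l.take L.length).map Prod.fst <+: L := by
  rw [List.map_take]
  cases N with
  | zero => simp at h; simp [h]
  | succ N =>
    have := h.take L.length
    simpa [List.replicate_succ] using this

/-- The matrix of the picks of a cyclic picking sequence, row by row. -/
theorem column_getElem? {l : List (Fin n × Fin m)} {L : List (Fin n)} (hL : L.Nodup) {N : ℕ}
    (h : l.map Prod.fst <+: (List.replicate N L).flatten) (p : ℕ) (hp : p < L.length) (j : ℕ) :
    (column l L[p])[j]? = l[j * L.length + p]?.map Prod.snd := by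
  induction j generalizing l N with
  | zero =>
    have h1 := take_fst_prefix h
    rw [← List.take_append_drop L.length l, column_append, column_of_prefix hL h1 p hp]
    rcases lt_or_ge p l.length with hlt | hge
    · simp [hp, hlt]
    · have h2 : l.drop L.length = [] := List.drop_eq_nil_of_le (by omega)
      simp [h2, column, hge]
  | succ j ih =>
    have h1 := take_fst_prefix h
    have h2 := ih (drop_fst_prefix h)
    rw [List.getElem?_drop] at h2
    rw [show (j + 1) * L.length + p = L.length + (j * L.length + p) by ring, ← h2]
    conv_lhs => rw [← List.take_append_drop L.length l]
    rw [column_append, column_of_prefix hL h1 p hp]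
    rcases lt_or_ge p l.length with hlt | hge
    · simp [hp, hlt]
    · have h2 : l.drop L.length = [] := List.drop_eq_nil_of_le (by omega)
      simp [h2, column, hge]

theorem column_drop {l : List (Fin n × Fin m)} {L : List (Fin n)} (hL : L.Nodup) {N : ℕ}
    (h : l.map Prod.fst <+: (List.replicate N L).flatten) {a : Fin n} (ha : a ∈ L) :
    column (l.drop L.length) a = (column l a).drop 1 := by
  obtain ⟨p, hp, rfl⟩ := List.getElem_of_mem ha
  refine List.ext_getElem? fun j => ?_
  rw [column_getElem? hL (drop_fst_prefix h) p hp, List.getElem?_drop, List.getElem?_drop,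
    column_getElem? hL h p hp]
  congr 2
  ring

/-- Row by row, agent `a` likes the own column at least as much as column `b`. -/
def RowDominates (R : Fin n → List (Fin m)) (a b : Fin n) : Prop :=
  ∀ (j : ℕ) (h : Fin m), (R b)[j]? = some h → ∃ g, (R a)[j]? = some g ∧ I.val a h ≤ I.val a g

theorem pickOrder_getElem? {l : List (Fin n × Fin m)} (h : l.Pairwise I.PickOrder) {i j : ℕ}
    (hij : i < j) {y : Fin n × Fin m} (hy : l[j]? = some y) :
    ∃ x, l[i]? = some x ∧ I.PickOrder x y := by
  obtain ⟨hj, rfl⟩ := List.getElem?_eq_some_iff.1 hy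
  exact ⟨l[i], by simp [hij.trans hj], List.pairwise_iff_getElem.1 h i j (hij.trans hj) hj hij⟩

/-- All comparisons of columns come from here: entry `i` of column `p` is pick number `i * L.length
+ p`, and an earlier pick is weakly preferred by its picker to any later one. -/
theorem exists_column_entry {l : List (Fin n × Fin m)} (hl : l.Pairwise I.PickOrder)
    {L : List (Fin n)} (hL : L.Nodup) {N : ℕ}
    (h : l.map Prod.fst <+: (List.replicate N L).flatten) {p q i j : ℕ} (hp : p < L.length)
    (hq : q < L.length) (hlt : i * L.length + p < j * L.length + q) {y : Fin m}
    (hy : (column l L[q])[j]? = some y) :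
    ∃ g, (column l L[p])[i]? = some g ∧ I.val L[p] y ≤ I.val L[p] g := by
  rw [column_getElem? hL h q hq, Option.map_eq_some_iff] at hy
  obtain ⟨z, hz, rfl⟩ := hy
  obtain ⟨x, hx, hxz⟩ := I.pickOrder_getElem? hl hlt hz
  have hx2 : (column l L[p])[i]? = some x.2 := by
    rw [column_getElem? hL h p hp, hx]
    rfl
  have hx1 : x.1 = L[p] := by
    have := mem_column.1 (List.mem_of_getElem? hx2)
    have hx' := List.mem_of_getElem? hx
    exact (congrArg Prod.fst
      (List.inj_on_of_nodup_map (I.nodup_snd_of_pairwise hl) this hx' rfl)).symm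
  exact ⟨x.2, hx2, hx1 ▸ hxz.le⟩

theorem rowDominates_column {l : List (Fin n × Fin m)} (hl : l.Pairwise I.PickOrder)
    {L : List (Fin n)} (hL : L.Nodup) {N : ℕ}
    (h : l.map Prod.fst <+: (List.replicate N L).flatten) :
    L.Pairwise (I.RowDominates (column l)) := by
  rw [List.pairwise_iff_getElem]
  intro p q hp hq hpq j y hy
  exact I.exists_column_entry hl hL h hp hq (by omega) hy

/-! ### Values of columns -/

theorem value_nonneg (a : Fin n) (S : Finset (Fin m)) : 0 ≤ I.value a S :=
  Finset.sum_nonneg fun g _ => I.nonneg a g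

theorem value_mono (a : Fin n) {S T : Finset (Fin m)} (h : S ⊆ T) : I.value a S ≤ I.value a T :=
  Finset.sum_le_sum_of_subset_of_nonneg h fun g _ _ => I.nonneg a g

theorem value_union_le (a : Fin n) (S T : Finset (Fin m)) :
    I.value a (S ∪ T) ≤ I.value a S + I.value a T := by
  have := Finset.sum_union_inter (s₁ := S) (s₂ := T) (f := I.val a)
  have h0 := I.value_nonneg a (S ∩ T)
  unfold value at *
  linarith

theorem value_toFinset (a : Fin n) {x : List (Fin m)} (hx : x.Nodup) :
    I.value a x.toFinset = (x.map (I.val a)).sum := by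
  unfold value
  exact List.sum_toFinset _ hx

theorem sum_le_sum_of_rows (a : Fin n) {x y : List (Fin m)}
    (h : ∀ (j : ℕ) (v : Fin m), y[j]? = some v → ∃ u, x[j]? = some u ∧ I.val a v ≤ I.val a u) :
    (y.map (I.val a)).sum ≤ (x.map (I.val a)).sum := by
  induction y generalizing x with
  | nil =>
    simp only [List.map_nil, List.sum_nil]
    exact List.sum_nonneg (by simp only [List.mem_map]; rintro _ ⟨g, -, rfl⟩; exact I.nonneg a g)
  | cons v y ih =>
    cases x with
    | nil => simpa using h 0 v
    | cons u x =>
      have h0 := h 0 v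
      simp only [List.getElem?_cons_zero, Option.some.injEq, exists_eq_left', forall_const] at h0
      have := ih fun j w hw => by simpa using h (j + 1) w (by simpa using hw)
      simp only [List.map_cons, List.sum_cons]
      linarith

variable {I} in
-- Comparison row by row survives deleting the same number of top rows from both columns; the stage
-- analysis uses this for 0, 1 and 2 rows.
theorem RowDominates.value_drop_le {R : Fin n → List (Fin m)} {a b : Fin n}
    (h : I.RowDominates R a b) (ha : (R a).Nodup) (hb : (R b).Nodup) (k : ℕ) :
    I.value a ((R b).drop k).toFinset ≤ I.value a ((R a).drop k).toFinset := by
  rw [I.value_toFinset a (hb.sublist (List.drop_sublist _ _)),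
    I.value_toFinset a (ha.sublist (List.drop_sublist _ _))]
  refine I.sum_le_sum_of_rows a fun j v hv => ?_
  rw [List.getElem?_drop] at hv ⊢
  exact h _ v hv

/-- Envy-freeness up to one item: even if `q` precedes `p` in each round, entry `j + 1` of column
`q` is picked after entry `j` of column `p`. Only the first item of column `q` is left
uncompensated. -/
theorem value_column_le_add_one {l : List (Fin n × Fin m)} (hl : l.Pairwise I.PickOrder)
    {L : List (Fin n)} (hL : L.Nodup) {N : ℕ}
    (h : l.map Prod.fst <+: (List.replicate N L).flatten) {p q : ℕ} (hp : p < L.length)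
    (hq : q < L.length) :
    I.value L[p] (column l L[q]).toFinset ≤
      I.value L[p] (column l L[p]).toFinset + if p ≤ q then 0 else 1 := by
  have hn := I.column_nodup hl
  split_ifs with hpq
  · rw [add_zero]
    rcases hpq.eq_or_lt with rfl | hlt
    · rfl
    · have := (List.pairwise_iff_getElem.1 (I.rowDominates_column hl hL h) p q hp hq hlt)
      exact this.value_drop_le (hn _) (hn _) 0
  · rw [I.value_toFinset _ (hn _), I.value_toFinset _ (hn _)]
    have key : (((column l L[q]).drop 1).map (I.val L[p])).sum ≤
        ((column l L[p]).map (I.val L[p])).sum := by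
      refine I.sum_le_sum_of_rows _ fun j v hv => ?_
      rw [List.getElem?_drop] at hv
      exact I.exists_column_entry hl hL h hp hq (by nlinarith) hv
    cases hc : column l L[q] with
    | nil =>
      rw [hc] at key
      simp only [List.drop_nil, List.map_nil, List.sum_nil] at key ⊢
      linarith
    | cons g t =>
      rw [hc] at key
      simp only [List.drop_succ_cons, List.drop_zero, List.map_cons, List.sum_cons] at key ⊢
      linarith [I.le_one L[p] g]

/-- Round-Robin gives everybody their proportional share up to less than one item. -/
theorem value_column_gt {l : List (Fin n × Fin m)} (hl : l.Pairwise I.PickOrder)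
    {L : List (Fin n)} (hL : L.Nodup) {N : ℕ}
    (h : l.map Prod.fst <+: (List.replicate N L).flatten) {p : ℕ} (hp : p < L.length) :
    I.value L[p] (pickedItems l) / L.length - 1 < I.value L[p] (column l L[p]).toFinset := by
  have hr : (0 : ℝ) < L.length := by exact_mod_cast (by omega : 0 < L.length)
  have hcover : pickedItems l = Finset.univ.biUnion fun q : Fin L.length =>
      (column l L[q]).toFinset := by
    ext g
    simp only [mem_pickedItems, Finset.mem_biUnion, Finset.mem_univ, true_and,
      List.mem_toFinset, mem_column]
    refine ⟨fun ⟨a, ha⟩ => ?_, fun ⟨q, hq⟩ => ⟨_, hq⟩⟩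
    have : a ∈ (List.replicate N L).flatten := h.subset (List.mem_map_of_mem (f := Prod.fst) ha)
    obtain ⟨L', hL', haL⟩ := List.mem_flatten.1 this
    rw [List.eq_of_mem_replicate hL'] at haL
    obtain ⟨q, hq, rfl⟩ := List.getElem_of_mem haL
    exact ⟨⟨q, hq⟩, ha⟩
  have hsum : I.value L[p] (pickedItems l) =
      ∑ q : Fin L.length, I.value L[p] (column l L[q]).toFinset := by
    rw [hcover]
    unfold value
    refine Finset.sum_biUnion fun x _ y _ hxy => I.column_disjoint hl fun e => hxy ?_
    exact Fin.ext ((hL.getElem_inj_iff).1 e)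
  -- Averaging over the columns loses less than 1, since the own column needs no extra item.
  have hlt : ∑ q : Fin L.length, I.value L[p] (column l L[q]).toFinset <
      ∑ q : Fin L.length, (I.value L[p] (column l L[p]).toFinset + 1) := by
    refine Finset.sum_lt_sum (fun q _ => ?_) ⟨⟨p, hp⟩, Finset.mem_univ _, ?_⟩
    · refine (I.value_column_le_add_one hl hL h hp q.2).trans ?_
      split_ifs <;> simp
    · simp
  rw [← hsum, Finset.sum_const, Finset.card_univ, Fintype.card_fin, nsmul_eq_mul] at hlt
  rw [sub_lt_iff_lt_add, div_lt_iff₀ hr]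
  linarith

/-! ### Passing to a later stage -/

theorem flatten_replicate_prefix (L : List (Fin n)) {M N : ℕ} (h : M ≤ N) :
    (List.replicate M L).flatten <+: (List.replicate N L).flatten := by
  obtain ⟨k, rfl⟩ := Nat.exists_eq_add_of_le h
  rw [List.replicate_add, List.flatten_append]
  exact List.prefix_append _ _

/-- The number of rounds is immaterial once it suffices for all items: both sequences of turns are
prefixes of a common longer one, so the shorter list of pickers is a prefix of either. -/
theorem serialPicks_cyclic {l : List (Fin n × Fin m)} (hl : l.Pairwise I.PickOrder)
    {L : List (Fin n)} (hL : L ≠ []) {N : ℕ}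
    (h : l.map Prod.fst <+: (List.replicate N L).flatten) :
    I.serialPicks (List.replicate (pickedItems l).card L).flatten (pickedItems l) = l := by
  refine I.serialPicks_eq hl _ ?_
  have hcard : (pickedItems l).card = l.length := by
    rw [pickedItems, List.toFinset_card_of_nodup (I.nodup_snd_of_pairwise hl), List.length_map]
  refine List.prefix_of_prefix_length_le
    (h.trans (flatten_replicate_prefix L (le_max_left N (pickedItems l).card)))
    (flatten_replicate_prefix L (le_max_right N (pickedItems l).card)) ?_
  have : 1 ≤ L.length := List.length_pos_iff.2 hL
  simp only [List.length_map, List.length_flatten, List.map_replicate, List.sum_replicate,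
    smul_eq_mul, hcard]
  nlinarith

/-- The picks of the agents in `L'` from the third round on. -/
def laterPicks (l : List (Fin n × Fin m)) (L L' : List (Fin n)) : List (Fin n × Fin m) :=
  ((l.drop L.length).drop L.length).filter fun x => x.1 ∈ L'

theorem laterPicks_pairwise {l : List (Fin n × Fin m)} (hl : l.Pairwise I.PickOrder)
    (L L' : List (Fin n)) : (laterPicks l L L').Pairwise I.PickOrder :=
  hl.sublist (List.filter_sublist.trans ((List.drop_sublist _ _).trans (List.drop_sublist _ _)))

theorem filter_mem_drop {L : List (Fin n)} (hL : L.Nodup) (k : ℕ) :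
    L.filter (fun a => a ∈ L.drop k) = L.drop k := by
  conv_lhs => rw [← List.take_append_drop k L]
  rw [List.filter_append]
  rw [← List.take_append_drop k L] at hL
  have hd := List.nodup_append.1 hL
  rw [List.filter_eq_nil_iff.2, List.filter_eq_self.2, List.nil_append]
  · intro a ha
    simpa using ha
  · intro a ha
    simpa using fun h => hd.2.2 a ha a h rfl

/-- Deleting two full rounds, and then all turns of the departed agents, leaves the cyclic sequence
of the donors. Sublists also inherit `PickOrder`, so the surviving picks are a Round-Robin outcome
again. -/
theorem laterPicks_fst_prefix {l : List (Fin n × Fin m)} {L : List (Fin n)} (hL : L.Nodup) {N : ℕ}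
    (h : l.map Prod.fst <+: (List.replicate N L).flatten) (k : ℕ) :
    (laterPicks l L (L.drop k)).map Prod.fst <+:
      (List.replicate (N - 1 - 1) (L.drop k)).flatten := by
  have h2 := (drop_fst_prefix (drop_fst_prefix h)).filter (fun a => a ∈ L.drop k)
  rw [List.filter_map, List.filter_flatten, List.map_replicate, filter_mem_drop hL] at h2
  exact h2

theorem column_laterPicks {l : List (Fin n × Fin m)} {L : List (Fin n)} (hL : L.Nodup) {N : ℕ}
    (h : l.map Prod.fst <+: (List.replicate N L).flatten) {k : ℕ} {a : Fin n}
    (ha : a ∈ L.drop k) : column (laterPicks l L (L.drop k)) a = (column l a).drop 2 := by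
  have haL : a ∈ L := List.mem_of_mem_drop ha
  have h1 : column (laterPicks l L (L.drop k)) a = column ((l.drop L.length).drop L.length) a := by
    unfold column laterPicks
    rw [List.filter_filter]
    congr 1
    refine List.filter_congr fun x _ => ?_
    by_cases hx : x.1 = a
    · simp [hx, ha]
    · simp [hx]
  rw [h1, column_drop hL (drop_fst_prefix h) haL, column_drop hL h haL, List.drop_drop]

theorem pickedItems_laterPicks {l : List (Fin n × Fin m)} {L : List (Fin n)} (hL : L.Nodup) {N : ℕ}
    (h : l.map Prod.fst <+: (List.replicate N L).flatten) (k : ℕ) :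
    pickedItems (laterPicks l L (L.drop k)) =
      (L.drop k).toFinset.biUnion fun d => ((column l d).drop 2).toFinset := by
  ext g
  simp only [mem_pickedItems, Finset.mem_biUnion, List.mem_toFinset]
  constructor
  · rintro ⟨a, ha⟩
    have haL : a ∈ L.drop k := by simpa using (List.mem_filter.1 ha).2
    exact ⟨a, haL, by rw [← column_laterPicks hL h haL, mem_column]; exact ha⟩
  · rintro ⟨a, haL, ha⟩
    rw [← column_laterPicks hL h haL, mem_column] at ha
    exact ⟨a, ha⟩

end FairInstance

namespace BoundedProp

open FairInstance

variable {n m : ℕ}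

/-! ### Transfers and swaps -/

theorem mem_transfer_self {P : Parts n m} {S : Finset (Fin m)} {a : Fin n} {g : Fin m} :
    g ∈ transfer P S a a ↔ g ∈ P a ∨ g ∈ S := by
  simp [transfer]

theorem transfer_of_ne {P : Parts n m} {S : Finset (Fin m)} {a q : Fin n} (h : q ≠ a) :
    transfer P S a q = P q \ S := by
  simp [transfer, h]

/-- The top entry of column `a`, as a set with at most one element. -/
def top (R : Fin n → List (Fin m)) (a : Fin n) : Finset (Fin m) := (R a)[0]?.toFinset

theorem top_subset (R : Fin n → List (Fin m)) (a : Fin n) : top R a ⊆ (R a).toFinset := by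
  intro g hg
  simp only [top, Option.mem_toFinset, Option.mem_def] at hg
  exact List.mem_toFinset.2 (List.mem_of_getElem? hg)

theorem cell_zero (R : Fin n → List (Fin m)) (P : Parts n m) (a : Fin n) :
    cell R P 0 a = top R a ∩ P a := rfl

/-- Swap the top entries of all pairs of the list, one pair after the other. -/
def swapAll (R : Fin n → List (Fin m)) (pairs : List (Fin n × Fin n)) (Q : Parts n m) :
    Parts n m :=
  pairs.foldl (fun Q x => swapTop R Q x.1 x.2) Q

theorem swapTop_subset {R : Fin n → List (Fin m)} {Q : Parts n m} {b d q : Fin n} (hb : q ≠ b)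
    (hd : q ≠ d) : swapTop R Q b d q ⊆ Q q := by
  rw [swapTop, transfer_of_ne hb, transfer_of_ne hd]
  exact Finset.sdiff_subset.trans Finset.sdiff_subset

theorem swapTop_fst_subset {R : Fin n → List (Fin m)} {Q : Parts n m} {b d : Fin n} (h : b ≠ d) :
    swapTop R Q b d b ⊆ (Q b \ top R b) ∪ (top R d ∩ Q d) := by
  intro g hg
  rw [swapTop, mem_transfer_self, transfer_of_ne h] at hg
  simp only [cell_zero, Finset.mem_sdiff, Finset.mem_inter, Finset.mem_union] at hg ⊢
  tauto

/-- The outgoing top item of `d` need not be subtracted: where the bound is applied, the donors' top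
items are worthless to the arriving agent. -/
theorem swapTop_snd_subset {R : Fin n → List (Fin m)} {Q : Parts n m} {b d : Fin n} (h : b ≠ d) :
    swapTop R Q b d d ⊆ Q d ∪ top R b := by
  intro g hg
  rw [swapTop, transfer_of_ne h.symm, Finset.mem_sdiff, mem_transfer_self] at hg
  simp only [cell_zero, Finset.mem_inter, Finset.mem_union] at hg ⊢
  tauto

theorem swapAll_subset {R : Fin n → List (Fin m)} (pairs : List (Fin n × Fin n)) (Q : Parts n m)
    {q : Fin n} (h : ∀ x ∈ pairs, q ≠ x.1 ∧ q ≠ x.2) : swapAll R pairs Q q ⊆ Q q := by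
  induction pairs generalizing Q with
  | nil => exact subset_rfl
  | cons x pairs ih =>
    have hx := h x (by simp)
    exact (ih (swapTop R Q x.1 x.2) fun y hy => h y (by simp [hy])).trans
      (swapTop_subset hx.1 hx.2)

theorem mem_swapAll {R : Fin n → List (Fin m)} (pairs : List (Fin n × Fin n)) (Q : Parts n m)
    {q : Fin n} {g : Fin m} (h : ∀ x ∈ pairs, q ≠ x.1 ∧ q ≠ x.2)
    (hg : ∀ x ∈ pairs, g ∉ top R x.1 ∧ g ∉ top R x.2) (hgQ : g ∈ Q q) :
    g ∈ swapAll R pairs Q q := by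
  induction pairs generalizing Q with
  | nil => exact hgQ
  | cons x pairs ih =>
    have hx := h x (by simp)
    have hgx := hg x (by simp)
    refine ih (swapTop R Q x.1 x.2) (fun y hy => h y (by simp [hy]))
      (fun y hy => hg y (by simp [hy])) ?_
    rw [swapTop, transfer_of_ne hx.1, transfer_of_ne hx.2]
    simp [cell_zero, hgQ, hgx]

/-- Upper bounds for the parts of a pair after the swaps. -/
theorem swapAll_pair_subset {R : Fin n → List (Fin m)} (pairs : List (Fin n × Fin n))
    (Q : Parts n m) (h1 : (pairs.map Prod.fst).Nodup) (h2 : (pairs.map Prod.snd).Nodup)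
    (h12 : ∀ x ∈ pairs, ∀ y ∈ pairs, x.1 ≠ y.2) {b d : Fin n} (hbd : (b, d) ∈ pairs) :
    swapAll R pairs Q b ⊆ (Q b \ top R b) ∪ (top R d ∩ Q d) ∧
      swapAll R pairs Q d ⊆ Q d ∪ top R b := by
  induction pairs generalizing Q with
  | nil => simp at hbd
  | cons x pairs ih =>
    rw [List.map_cons, List.nodup_cons] at h1 h2
    rcases List.mem_cons.1 hbd with rfl | hmem
    · have hne : b ≠ d := h12 (b, d) hbd (b, d) hbd
      have hb : ∀ y ∈ pairs, b ≠ y.1 ∧ b ≠ y.2 := fun y hy =>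
        ⟨fun e => h1.1 (List.mem_map.2 ⟨y, hy, e.symm⟩), h12 (b, d) hbd y (by simp [hy])⟩
      have hd : ∀ y ∈ pairs, d ≠ y.1 ∧ d ≠ y.2 := fun y hy =>
        ⟨(h12 y (by simp [hy]) (b, d) hbd).symm,
          fun e => h2.1 (List.mem_map.2 ⟨y, hy, e.symm⟩)⟩
      exact ⟨(swapAll_subset pairs _ hb).trans (swapTop_fst_subset hne),
        (swapAll_subset pairs _ hd).trans (swapTop_snd_subset hne)⟩
    · have hb : swapTop R Q x.1 x.2 b ⊆ Q b := swapTop_subset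
        (fun e => h1.1 (List.mem_map.2 ⟨_, hmem, e⟩)) (h12 _ hbd x (by simp))
      have hd : swapTop R Q x.1 x.2 d ⊆ Q d := swapTop_subset
        (h12 x (by simp) _ hbd).symm (fun e => h2.1 (List.mem_map.2 ⟨_, hmem, e⟩))
      obtain ⟨ih1, ih2⟩ := ih (swapTop R Q x.1 x.2) h1.2 h2.2
        (fun y hy z hz => h12 y (by simp [hy]) z (by simp [hz])) hmem
      exact ⟨ih1.trans (Finset.union_subset_union (Finset.sdiff_subset_sdiff hb subset_rfl)
        (Finset.inter_subset_inter_left hd)), ih2.trans (Finset.union_subset_union_left hd)⟩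

/-! ### The arrival of an agent -/

/-- Strict preference makes the pick independent of the tie-breaking. -/
theorem present_choice {I : FairInstance n m} {c : Choice n m} (hc : I.IsRational c) {a : Fin n}
    {avail : Finset (Fin n)} {P : Parts n m} (ha : a ∈ avail)
    (h : ∀ q ∈ avail, q ≠ a → I.value a (P q) < I.value a (P a)) : c a avail P = a := by
  obtain ⟨h1, h2⟩ := hc a avail P ⟨a, ha⟩
  by_contra hne
  exact absurd (h2 a ha) (not_le.2 (h _ h1 hne))

/-- The state in which the agents in `as` are still to arrive, after everybody before them has
taken their own part. -/
structure StageInv (R : Fin n → List (Fin m)) (donors as : List (Fin n)) (s : StageState n m) :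
    Prop where
  avail_eq : s.avail = (as ++ donors).toFinset
  parts_eq : ∀ q ∈ as, s.parts q = (R q).toFinset
  parts_subset : ∀ d ∈ donors, s.parts d ⊆ (R d).toFinset
  subset_parts : ∀ d ∈ donors, ((R d).drop 2).toFinset ⊆ s.parts d

/-- The second pick of agent `a` has positive value for them, and thus also the first pick. -/
def HasTwoPositive (I : FairInstance n m) (R : Fin n → List (Fin m)) (a : Fin n) : Prop :=
  ∃ g h t, R a = g :: h :: t ∧ 0 < I.val a g ∧ 0 < I.val a h

theorem mem_drop_two_or {x : List (Fin m)} {g : Fin m} (hg : g ∈ x) :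
    x[0]? = some g ∨ x[1]? = some g ∨ g ∈ x.drop 2 := by
  match x, hg with
  | [_], hg => simpa [eq_comm] using hg
  | _ :: _ :: _, hg => simpa [eq_comm] using hg

theorem notMem_drop_two {x : List (Fin m)} (hx : x.Nodup) {g : Fin m}
    (h : x[0]? = some g ∨ x[1]? = some g) : g ∉ x.drop 2 := by
  match x, hx, h with
  | [], _, _ => simp
  | [_], _, _ => simp
  | u :: v :: t, hx, h =>
    simp only [List.nodup_cons, List.mem_cons, not_or] at hx
    simp only [List.getElem?_cons_zero, List.getElem?_cons_succ, Option.some.injEq] at h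
    rcases h with rfl | rfl
    · exact hx.1.2
    · exact hx.2.1

theorem mem_donorItems {R : Fin n → List (Fin m)} {P : Parts n m} {avail : Finset (Fin n)}
    {donors : List (Fin n)} {g : Fin m} :
    g ∈ donorItems R P avail donors ↔ ∃ d ∈ donors, d ∈ avail ∧
      ((R d)[0]? = some g ∨ (R d)[1]? = some g) ∧ g ∈ P d := by
  simp only [donorItems, cell, Finset.mem_biUnion, Finset.mem_inter, List.mem_toFinset,
    Finset.mem_union, Option.mem_toFinset, Option.mem_def]
  constructor
  · rintro ⟨d, ⟨h1, h2⟩, h3⟩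
    exact ⟨d, h1, h2, by tauto, by tauto⟩
  · rintro ⟨d, h1, h2, h3, h4⟩
    exact ⟨d, ⟨h1, h2⟩, by tauto⟩

section Arrival

variable {I : FairInstance n m} {c : Choice n m} {R : Fin n → List (Fin m)}
  {donors later : List (Fin n)} {a : Fin n} {s : StageState n m}

theorem HasTwoPositive.value_drop_two_lt (hnd : (R a).Nodup) (h : HasTwoPositive I R a) :
    I.value a ((R a).drop 2).toFinset < I.value a (R a).toFinset := by
  rw [I.value_toFinset a (hnd.sublist (List.drop_sublist _ _)), I.value_toFinset a hnd]
  obtain ⟨g, h', t, e, h1, h2⟩ := h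
  simp only [e, List.drop_succ_cons, List.drop_zero, List.map_cons, List.sum_cons]
  linarith

theorem HasTwoPositive.value_drop_one_lt (hnd : (R a).Nodup) (h : HasTwoPositive I R a) :
    I.value a ((R a).drop 1).toFinset < I.value a (R a).toFinset := by
  rw [I.value_toFinset a (hnd.sublist (List.drop_sublist _ _)), I.value_toFinset a hnd]
  obtain ⟨g, h', t, e, h1, h2⟩ := h
  simp only [e, List.drop_succ_cons, List.drop_zero, List.map_cons, List.sum_cons]
  linarith

/-- This comparison is what requires the second pick to be positive. A donor who receives a swapped
top item may look like the own column without its second entry. -/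
theorem HasTwoPositive.value_top_add_lt (hnd : (R a).Nodup) (h : HasTwoPositive I R a) :
    I.value a (top R a) + I.value a ((R a).drop 2).toFinset < I.value a (R a).toFinset := by
  rw [I.value_toFinset a (hnd.sublist (List.drop_sublist _ _)), I.value_toFinset a hnd]
  obtain ⟨g, h', t, e, h1, h2⟩ := h
  have htop : I.value a (top R a) = I.val a g := by simp [value, top, e]
  rw [htop]
  simp only [e, List.drop_succ_cons, List.drop_zero, List.map_cons, List.sum_cons]
  linarith

theorem value_top_le {b : Fin n} (h : I.RowDominates R a b) :
    I.value a (top R b) ≤ I.value a (top R a) := by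
  cases hb : (R b)[0]? with
  | none =>
    have : top R b = ∅ := by simp [top, hb]
    rw [this]
    simpa [value] using I.value_nonneg a (top R a)
  | some x =>
    obtain ⟨g, hg, hle⟩ := h 0 x hb
    have h1 : top R b = {x} := by simp [top, hb]
    have h2 : top R a = {g} := by simp [top, hg]
    simpa [h1, h2, value] using hle

theorem value_union_le_of_zero {S T : Finset (Fin m)} (hT : ∀ g ∈ T, I.val a g = 0) :
    I.value a (S ∪ T) ≤ I.value a S := by
  refine (I.value_union_le a S T).trans ?_
  have : I.value a T = 0 := Finset.sum_eq_zero hT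
  linarith

/-- The part of the last agent of a stage, with all donated items, is the unique best part. -/
theorem choice_last (hc : I.IsRational c) (hinv : StageInv R donors [a] s)
    (hRnd : ∀ q, (R q).Nodup) (hdom : ∀ q ∈ donors, I.RowDominates R a q) (hgood : HasTwoPositive I R a) :
    c a s.avail (transfer s.parts (donorItems R s.parts s.avail donors) a) = a := by
  have hav : s.avail = (a :: donors).toFinset := hinv.avail_eq
  refine present_choice hc (by simp [hav]) fun q hq hqa => ?_
  have hq' : q ∈ donors := by
    simp only [hav, List.mem_toFinset, List.mem_cons] at hq
    exact hq.resolve_left hqa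
  -- All that is left in the top two rows of the donors has been moved away.
  have hsub : transfer s.parts (donorItems R s.parts s.avail donors) a q ⊆
      ((R q).drop 2).toFinset := by
    intro g hg
    rw [transfer_of_ne hqa, Finset.mem_sdiff, mem_donorItems] at hg
    have hgR := List.mem_toFinset.1 (hinv.parts_subset q hq' hg.1)
    rcases mem_drop_two_or hgR with h | h | h
    · exact absurd ⟨q, hq', hq, Or.inl h, hg.1⟩ hg.2
    · exact absurd ⟨q, hq', hq, Or.inr h, hg.1⟩ hg.2
    · exact List.mem_toFinset.2 h
  calc _ ≤ _ := I.value_mono a hsub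
    _ ≤ _ := (hdom q hq').value_drop_le (hRnd a) (hRnd q) 2
    _ < _ := hgood.value_drop_two_lt (hRnd a)
    _ ≤ _ := I.value_mono a fun g hg => mem_transfer_self.2
      (Or.inl (by rwa [hinv.parts_eq a (by simp)]))

/-- After receiving a donated item of positive value, the own part is the unique best part. -/
theorem choice_donated (hc : I.IsRational c) (hinv : StageInv R donors (a :: later) s)
    (hnd : (a :: later ++ donors).Nodup) (hRnd : ∀ q, (R q).Nodup)
    (hRd : ∀ p q, p ≠ q → Disjoint (R p).toFinset (R q).toFinset)
    (hdom : ∀ q ∈ later ++ donors, I.RowDominates R a q) {g : Fin m}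
    (hg : g ∈ donorItems R s.parts s.avail donors) (hpos : 0 < I.val a g) :
    c a s.avail (transfer s.parts {g} a) = a := by
  have hav : s.avail = (a :: (later ++ donors)).toFinset := hinv.avail_eq
  obtain ⟨d, hd, hdav, -, hgd⟩ := mem_donorItems.1 hg
  have hda : d ≠ a := by
    rintro rfl
    simp only [List.cons_append, List.nodup_cons, List.mem_append, not_or] at hnd
    exact hnd.1.2 hd
  refine present_choice hc (by simp [hav]) fun q hq hqa => ?_
  have hq' : q ∈ later ++ donors := by
    simp only [hav, List.mem_toFinset, List.mem_cons] at hq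
    exact hq.resolve_left hqa
  have hsub : s.parts q ⊆ (R q).toFinset := by
    rcases List.mem_append.1 hq' with h | h
    · rw [hinv.parts_eq q (by simp [h])]
    · exact hinv.parts_subset q h
  -- The moved item comes from a different column, so it adds its full positive value.
  have hga : g ∉ (R a).toFinset :=
    Finset.disjoint_left.1 (hRd d a hda) (hinv.parts_subset d hd hgd)
  have hPa : transfer s.parts {g} a a = insert g (R a).toFinset := by
    ext x
    rw [mem_transfer_self, hinv.parts_eq a (by simp)]
    simp [or_comm]
  have hval : I.value a (insert g (R a).toFinset) = I.val a g + I.value a (R a).toFinset :=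
    Finset.sum_insert hga
  have h1 : I.value a (transfer s.parts {g} a q) ≤ I.value a (R q).toFinset := by
    rw [transfer_of_ne hqa]
    exact I.value_mono a (Finset.sdiff_subset.trans hsub)
  have h2 := (hdom q hq').value_drop_le (hRnd a) (hRnd q) 0
  simp only [List.drop_zero] at h2
  rw [hPa, hval]
  linarith

/-- If the donated items are worthless, then in the temporary partition the own part is unchanged
and the unique best part. -/
theorem choice_rebundle (hc : I.IsRational c) (hinv : StageInv R donors (a :: later) s)
    (hnd : (a :: later ++ donors).Nodup) (hRnd : ∀ q, (R q).Nodup)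
    (hRd : ∀ p q, p ≠ q → Disjoint (R p).toFinset (R q).toFinset)
    (hdom : ∀ q ∈ later ++ donors, I.RowDominates R a q) (hlen : later.length ≤ donors.length)
    (hgood : HasTwoPositive I R a)
    (hzero : ∀ g ∈ donorItems R s.parts s.avail donors, I.val a g = 0) :
    rebundle R s.parts s.avail (later.zip donors) a = s.parts a ∧
      c a s.avail (rebundle R s.parts s.avail (later.zip donors)) = a := by
  have hav : s.avail = (a :: (later ++ donors)).toFinset := hinv.avail_eq
  simp only [List.cons_append, List.nodup_cons, List.mem_append, not_or] at hnd
  obtain ⟨⟨hal, had⟩, hnd⟩ := hnd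
  obtain ⟨hnl, hndon, hld⟩ := List.nodup_append.1 hnd
  -- All later agents and donors are still unpicked, so no pair is filtered out.
  have hP : rebundle R s.parts s.avail (later.zip donors) =
      swapAll R (later.zip donors) s.parts := by
    unfold rebundle swapAll
    rw [List.filter_eq_self.2]
    intro x hx
    have := List.of_mem_zip (a := x.1) (b := x.2) hx
    simp [hav, this]
  rw [hP]
  have hout : ∀ x ∈ later.zip donors, a ≠ x.1 ∧ a ≠ x.2 := fun x hx => by
    have := List.of_mem_zip (a := x.1) (b := x.2) hx
    exact ⟨fun e => hal (e ▸ this.1), fun e => had (e ▸ this.2)⟩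
  have hPa : swapAll R (later.zip donors) s.parts a = s.parts a := by
    refine Finset.Subset.antisymm (swapAll_subset _ _ hout) fun g hg => ?_
    refine mem_swapAll _ _ hout (fun x hx => ?_) hg
    rw [hinv.parts_eq a (by simp)] at hg
    exact ⟨fun h => Finset.disjoint_left.1 (hRd _ _ (hout x hx).1) hg (top_subset R _ h),
      fun h => Finset.disjoint_left.1 (hRd _ _ (hout x hx).2) hg (top_subset R _ h)⟩
  refine ⟨hPa, present_choice hc (by simp [hav]) fun q hq hqa => ?_⟩
  rw [hPa, hinv.parts_eq a (by simp)]
  -- The donors' remaining top two rows are worthless to `a`, so before the swaps a donor's part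
  -- counts at most as its rows from the third on.
  have hdonor : ∀ d ∈ donors, I.value a (s.parts d) ≤ I.value a ((R a).drop 2).toFinset := by
    intro d hd
    have hsub : s.parts d ⊆ ((R d).drop 2).toFinset ∪
        donorItems R s.parts s.avail donors := by
      intro g hg
      have hdav : d ∈ s.avail := by simp [hav, hd]
      rw [Finset.mem_union, mem_donorItems]
      rcases mem_drop_two_or (List.mem_toFinset.1 (hinv.parts_subset d hd hg)) with h | h | h
      · exact Or.inr ⟨d, hd, hdav, Or.inl h, hg⟩
      · exact Or.inr ⟨d, hd, hdav, Or.inr h, hg⟩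
      · exact Or.inl (List.mem_toFinset.2 h)
    calc _ ≤ _ := I.value_mono a hsub
      _ ≤ _ := value_union_le_of_zero hzero
      _ ≤ _ := (hdom d (by simp [hd])).value_drop_le (hRnd a) (hRnd d) 2
  have hpair : ∀ b d, (b, d) ∈ later.zip donors →
      swapAll R (later.zip donors) s.parts b ⊆ (s.parts b \ top R b) ∪ (top R d ∩ s.parts d) ∧
        swapAll R (later.zip donors) s.parts d ⊆ s.parts d ∪ top R b := by
    intro b d hbd
    refine swapAll_pair_subset _ _ ?_ ?_ ?_ hbd
    · exact hnl.sublist (by rw [List.map_fst_zip hlen])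
    · refine hndon.sublist ?_
      have : (later.zip donors).map Prod.snd = donors.take later.length :=
        List.ext_getElem (by simp) (by simp)
      rw [this]
      exact List.take_sublist _ _
    · intro x hx y hy
      exact hld _ (List.of_mem_zip (a := x.1) (b := x.2) hx).1 _
        (List.of_mem_zip (a := y.1) (b := y.2) hy).2
  -- A later agent's part loses its top item for a worthless one. Every later agent has a partner,
  -- because there are at least as many donors. A donor's part gains at most one top item, or
  -- nothing if it has no partner.
  by_cases hql : q ∈ later
  · obtain ⟨d, hqd⟩ : ∃ d, (q, d) ∈ later.zip donors := by
      have : q ∈ (later.zip donors).map Prod.fst := by rwa [List.map_fst_zip hlen]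
      obtain ⟨x, hx, rfl⟩ := List.mem_map.1 this
      exact ⟨x.2, hx⟩
    have hd : d ∈ donors := (List.of_mem_zip hqd).2
    have hsub1 : s.parts q \ top R q ⊆ ((R q).drop 1).toFinset := by
      rw [hinv.parts_eq q (by simp [hql])]
      intro g hg
      cases hRq : R q with
      | nil => simp [hRq] at hg
      | cons x t =>
        simp only [hRq, top, List.toFinset_cons, List.getElem?_cons_zero, Option.toFinset_some,
          Finset.mem_sdiff, Finset.mem_insert, Finset.mem_singleton, List.mem_toFinset] at hg
        simpa using hg.1.resolve_left hg.2
    have hz : ∀ g ∈ top R d ∩ s.parts d, I.val a g = 0 := by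
      intro g hg
      simp only [top, Finset.mem_inter, Option.mem_toFinset, Option.mem_def] at hg
      exact hzero g (mem_donorItems.2 ⟨d, hd, by simp [hav, hd], Or.inl hg.1, hg.2⟩)
    calc _ ≤ _ := I.value_mono a (hpair q d hqd).1
      _ ≤ _ := value_union_le_of_zero hz
      _ ≤ _ := I.value_mono a hsub1
      _ ≤ _ := (hdom q (by simp [hql])).value_drop_le (hRnd a) (hRnd q) 1
      _ < _ := hgood.value_drop_one_lt (hRnd a)
  · have hqd : q ∈ donors := by
      simp only [hav, List.mem_toFinset, List.mem_cons, List.mem_append] at hq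
      tauto
    by_cases hex : ∃ b, (b, q) ∈ later.zip donors
    · obtain ⟨b, hbq⟩ := hex
      have hb : b ∈ later := (List.of_mem_zip hbq).1
      have h1 := I.value_mono a (hpair b q hbq).2
      have h2 := I.value_union_le a (s.parts q) (top R b)
      have h3 := hdonor q hqd
      have h4 := value_top_le (hdom b (by simp [hb]))
      have h5 := hgood.value_top_add_lt (hRnd a)
      linarith
    · have : ∀ x ∈ later.zip donors, q ≠ x.1 ∧ q ≠ x.2 := fun x hx =>
        ⟨fun e => hql (e ▸ (List.of_mem_zip (a := x.1) (b := x.2) hx).1),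
          fun e => hex ⟨x.1, e ▸ hx⟩⟩
      calc _ ≤ _ := I.value_mono a (swapAll_subset _ _ this)
        _ ≤ _ := hdonor q hqd
        _ < _ := hgood.value_drop_two_lt (hRnd a)

theorem StageInv.erase_avail (hinv : StageInv R donors (a :: later) s)
    (hnd : (a :: later ++ donors).Nodup) : s.avail.erase a = (later ++ donors).toFinset := by
  simp only [List.cons_append, List.nodup_cons] at hnd
  rw [hinv.avail_eq, List.cons_append, List.toFinset_cons, Finset.erase_insert]
  simpa using hnd.1

/-- An agent whose first two picks are of positive value takes the own part, and all stays in
order for those who arrive later. -/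
theorem arrive_spec (hc : I.IsRational c) (hinv : StageInv R donors (a :: later) s)
    (hnd : (a :: later ++ donors).Nodup) (hRnd : ∀ q, (R q).Nodup)
    (hRd : ∀ p q, p ≠ q → Disjoint (R p).toFinset (R q).toFinset)
    (hdom : ∀ q ∈ later ++ donors, I.RowDominates R a q) (hlen : later.length ≤ donors.length)
    (hgood : HasTwoPositive I R a) :
    StageInv R donors later (arrive I c R donors later a s) ∧
      I.value a (R a).toFinset ≤ I.value a ((arrive I c R donors later a s).got a) ∧
      (later = [] → ∀ d ∈ donors,
        (arrive I c R donors later a s).parts d = ((R d).drop 2).toFinset) := by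
  have hav : s.avail = (a :: (later ++ donors)).toFinset := hinv.avail_eq
  have haav : a ∈ s.avail := by simp [hav]
  have herase := hinv.erase_avail hnd
  have hpa := hinv.parts_eq a (by simp)
  have hnd' := hnd
  simp only [List.cons_append, List.nodup_cons, List.mem_append, not_or] at hnd'
  obtain ⟨⟨hal, had⟩, hnd'⟩ := hnd'
  have hld := (List.nodup_append.1 hnd').2.2
  unfold arrive
  simp only [haav, not_true_eq_false, if_false]
  split_ifs with hlater hpos
  · subst hlater
    have hch := choice_last hc hinv hRnd (by simpa using hdom) hgood
    have hparts : ∀ d ∈ donors, transfer s.parts (donorItems R s.parts s.avail donors) a d =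
        ((R d).drop 2).toFinset := by
      intro d hd
      have hda : d ≠ a := fun e => had (e ▸ hd)
      have hdav : d ∈ s.avail := by simp [hav, hd]
      rw [transfer_of_ne hda]
      ext g
      rw [Finset.mem_sdiff, mem_donorItems, List.mem_toFinset]
      constructor
      · rintro ⟨hg, hnot⟩
        rcases mem_drop_two_or (List.mem_toFinset.1 (hinv.parts_subset d hd hg)) with h | h | h
        · exact absurd ⟨d, hd, hdav, Or.inl h, hg⟩ hnot
        · exact absurd ⟨d, hd, hdav, Or.inr h, hg⟩ hnot
        · exact h
      · intro hg
        -- The donated items lie in the top two rows, and columns are disjoint without repetitions;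
        -- lower rows are never touched.
        refine ⟨hinv.subset_parts d hd (List.mem_toFinset.2 hg), ?_⟩
        rintro ⟨d', hd', -, hrow, hgd'⟩
        by_cases e : d' = d
        · subst e
          exact notMem_drop_two (hRnd d') hrow hg
        · exact Finset.disjoint_left.1 (hRd d' d e) (hinv.parts_subset d' hd' hgd')
            (List.mem_toFinset.2 (List.mem_of_mem_drop hg))
    refine ⟨⟨?_, by simp, ?_, ?_⟩, ?_, fun _ d hd => ?_⟩
    · simp only [present, hch, herase]
    · intro d hd
      simp only [present, hparts d hd]
      intro g hg
      exact List.mem_toFinset.2 (List.mem_of_mem_drop (List.mem_toFinset.1 hg))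
    · intro d hd
      simp only [present, hparts d hd]
      exact subset_rfl
    · simp only [present, hch, Function.update_self]
      exact I.value_mono a fun g hg => mem_transfer_self.2 (Or.inl (by rwa [hpa]))
    · simp only [present, hparts d hd]
  · set g := Finset.min' _ hpos with hgdef
    have hg := Finset.min'_mem _ hpos
    rw [← hgdef, Finset.mem_filter] at hg
    have hch := choice_donated hc hinv hnd hRnd hRd hdom hg.1 hg.2
    obtain ⟨d', hd', -, hrow, hgd'⟩ := mem_donorItems.1 hg.1
    have hgR := hinv.parts_subset d' hd' hgd'
    refine ⟨⟨?_, fun q hq => ?_, fun d hd => ?_, fun d hd => ?_⟩, ?_, fun h => absurd h hlater⟩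
    · simp only [present, hch, herase]
    · have hqa : q ≠ a := fun e => hal (e ▸ hq)
      simp only [present]
      rw [transfer_of_ne hqa, hinv.parts_eq q (by simp [hq])]
      rw [Finset.sdiff_singleton_eq_erase]
      exact Finset.erase_eq_of_notMem
        (Finset.disjoint_left.1 (hRd d' q (hld q hq d' hd').symm) hgR)
    · have hda : d ≠ a := fun e => had (e ▸ hd)
      simp only [present]
      rw [transfer_of_ne hda]
      exact Finset.sdiff_subset.trans (hinv.parts_subset d hd)
    · have hda : d ≠ a := fun e => had (e ▸ hd)
      simp only [present]
      rw [transfer_of_ne hda]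
      intro x hx
      refine Finset.mem_sdiff.2 ⟨hinv.subset_parts d hd hx, ?_⟩
      rw [Finset.mem_singleton]
      rintro rfl
      rw [List.mem_toFinset] at hx
      by_cases e : d' = d
      · subst e
        exact notMem_drop_two (hRnd d') hrow hx
      · exact Finset.disjoint_left.1 (hRd d' d e) hgR
          (List.mem_toFinset.2 (List.mem_of_mem_drop hx))
    · simp only [present, hch, Function.update_self]
      exact I.value_mono a fun x hx => mem_transfer_self.2 (Or.inl (by rwa [hpa]))
  · have hzero : ∀ g ∈ donorItems R s.parts s.avail donors, I.val a g = 0 := by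
      intro g hg
      by_contra hne
      exact hpos ⟨g, Finset.mem_filter.2 ⟨hg, lt_of_le_of_ne (I.nonneg a g) (Ne.symm hne)⟩⟩
    -- The part taken was unaffected by the swaps, so the temporary partition is discarded and the
    -- invariant is inherited unchanged.
    obtain ⟨hPa, hch⟩ := choice_rebundle hc hinv hnd hRnd hRd hdom hlen hgood hzero
    refine ⟨⟨?_, fun q hq => ?_, fun d hd => ?_, fun d hd => ?_⟩, ?_, fun h => absurd h hlater⟩
    · simp only [present, hch, herase]
    · simp only [present, hch, hPa, if_true]
      exact hinv.parts_eq q (by simp [hq])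
    · simp only [present, hch, hPa, if_true]
      exact hinv.parts_subset d hd
    · simp only [present, hch, hPa, if_true]
      exact hinv.subset_parts d hd
    · simp only [present, hch, Function.update_self, hPa, hpa, le_refl]

theorem arrive_got_of_ne {q : Fin n} (hq : q ≠ a) :
    (arrive I c R donors later a s).got q = s.got q := by
  unfold arrive
  dsimp only
  split_ifs <;> simp [present, hq]

theorem picking_got_of_notMem (as : List (Fin n)) {q : Fin n} (hq : q ∉ as) (s : StageState n m) :
    (picking I c R donors as s).got q = s.got q := by
  induction as generalizing s with
  | nil => rfl
  | cons a later ih =>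
    rw [List.mem_cons, not_or] at hq
    rw [picking, ih hq.2, arrive_got_of_ne hq.1]

/-- The picking phase: as long as all agents have two picks of positive value, they receive at
least their own part. -/
theorem picking_value (hc : I.IsRational c) (as : List (Fin n)) (hinv : StageInv R donors as s)
    (hnd : (as ++ donors).Nodup) (hRnd : ∀ q, (R q).Nodup)
    (hRd : ∀ p q, p ≠ q → Disjoint (R p).toFinset (R q).toFinset)
    (hdom : (as ++ donors).Pairwise (I.RowDominates R)) (hlen : as.length ≤ donors.length + 1)
    (k : ℕ) (hk : k < as.length)
    (hgood : ∀ j (hj : j < as.length), j ≤ k → HasTwoPositive I R as[j]) :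
    I.value as[k] (R as[k]).toFinset ≤ I.value as[k] ((picking I c R donors as s).got as[k]) := by
  induction as generalizing s k with
  | nil => simp at hk
  | cons a later ih =>
    have hd := List.pairwise_cons.1 hdom
    have hl : later.length ≤ donors.length := by simpa using hlen
    have hnd' := List.nodup_cons.1 hnd
    have hsp := arrive_spec hc hinv hnd hRnd hRd hd.1 hl (hgood 0 (by simp) (by omega))
    rw [picking]
    cases k with
    | zero =>
      simp only [List.getElem_cons_zero]
      rw [picking_got_of_notMem later fun h => hnd'.1 (by simp [h])]
      exact hsp.2.1
    | succ k =>
      simp only [List.getElem_cons_succ]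
      exact ih hsp.1 hnd'.2 hd.2 (by omega) k (by simpa using hk) fun j hj hjk => by
        exact hgood (j + 1) (by simpa using hj) (by omega)

/-- If all agents of a stage have two picks of positive value, then the donors keep their columns
up to the first two rows. -/
theorem picking_parts (hc : I.IsRational c) (as : List (Fin n)) (has : as ≠ [])
    (hinv : StageInv R donors as s)
    (hnd : (as ++ donors).Nodup) (hRnd : ∀ q, (R q).Nodup)
    (hRd : ∀ p q, p ≠ q → Disjoint (R p).toFinset (R q).toFinset)
    (hdom : (as ++ donors).Pairwise (I.RowDominates R)) (hlen : as.length ≤ donors.length + 1)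
    (hgood : ∀ a ∈ as, HasTwoPositive I R a) :
    (picking I c R donors as s).avail = donors.toFinset ∧
      ∀ d ∈ donors, (picking I c R donors as s).parts d = ((R d).drop 2).toFinset := by
  induction as generalizing s with
  | nil => exact absurd rfl has
  | cons a later ih =>
    have hd := List.pairwise_cons.1 hdom
    have hl : later.length ≤ donors.length := by simpa using hlen
    have hnd' := List.nodup_cons.1 hnd
    have hsp := arrive_spec hc hinv hnd hRnd hRd hd.1 hl (hgood a (by simp))
    rw [picking]
    by_cases hlater : later = []
    · subst hlater
      exact ⟨hsp.1.avail_eq, hsp.2.2 rfl⟩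
    · exact ih hlater hsp.1 hnd'.2 hd.2 (by omega) fun b hb => hgood b (by simp [hb])

end Arrival

end BoundedProp

/-! ### Recursion over the stages. -/

namespace BoundedProp

open FairInstance

variable {n m : ℕ} {I : FairInstance n m} {c : Choice n m}

/-- The number of stages that an agent spends among the donors, if they are at position `p`
(counted from `0`) of `r` agents. -/
def depth (r p : ℕ) : ℕ :=
  if h : 2 ≤ r ∧ r / 2 ≤ p then depth (r - r / 2) (p - r / 2) + 1 else 0
  termination_by r
  decreasing_by omega

theorem depth_of_lt {r p : ℕ} (h : p < r / 2) : depth r p = 0 := by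
  rw [depth, dif_neg (by omega)]

theorem depth_of_le {r p : ℕ} (hr : 2 ≤ r) (h : r / 2 ≤ p) :
    depth r p = depth (r - r / 2) (p - r / 2) + 1 := by
  rw [depth, dif_pos ⟨hr, h⟩]

/-- Since `p < r`, the new position `p - r / 2` is at most `r / 2`. Each stage among the donors
therefore at least halves the position. -/
theorem two_pow_depth_le {r p : ℕ} (hp : p < r) (h : depth r p ≠ 0) :
    2 ^ (depth r p - 1) ≤ p := by
  induction r using Nat.strong_induction_on generalizing p with
  | _ r ih =>
    by_cases hr : 2 ≤ r ∧ r / 2 ≤ p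
    · rw [depth_of_le hr.1 hr.2, Nat.add_sub_cancel]
      by_cases h0 : depth (r - r / 2) (p - r / 2) = 0
      · rw [h0, pow_zero]
        omega
      · have h1 := ih (r - r / 2) (by omega) (p := p - r / 2) (by omega) h0
        obtain ⟨d, hd⟩ := Nat.exists_eq_succ_of_ne_zero h0
        rw [hd, Nat.succ_eq_add_one, Nat.add_sub_cancel] at h1
        rw [hd, Nat.succ_eq_add_one, pow_succ]
        omega
    · rw [depth, dif_neg hr] at h
      exact absurd rfl h

/-- A positive depth `d + 1` gives `2 ^ d ≤ k < k + 1`. The strict inequality lets the ceiling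
absorb the extra stage. -/
theorem depth_le_logPos (k : Fin n) : (depth n k : ℤ) ≤ logPos k := by
  by_cases h0 : depth n k = 0
  · rw [h0]
    exact Int.ceil_nonneg (Real.logb_nonneg (by norm_num) (by simp))
  · obtain ⟨d, hd⟩ := Nat.exists_eq_succ_of_ne_zero h0
    have h1 := two_pow_depth_le k.2 h0
    rw [hd, Nat.succ_eq_add_one, Nat.add_sub_cancel] at h1
    have h2 : (2 : ℝ) ^ d < (k : ℝ) + 1 := by
      have : (2 : ℝ) ^ d ≤ (k : ℝ) := by exact_mod_cast h1
      linarith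
    have h3 : (d : ℝ) < Real.logb 2 ((k : ℝ) + 1) := by
      rw [Real.lt_logb_iff_rpow_lt (by norm_num) (by positivity), Real.rpow_natCast]
      exact h2
    have h4 : (d : ℤ) < logPos k := Int.lt_ceil.2 (by exact_mod_cast h3)
    rw [hd]
    push_cast
    omega

theorem run_of_two_le {L : List (Fin n)} (hL : 2 ≤ L.length) (U : Finset (Fin m))
    (got : Parts n m) :
    run I c L U got =
      let s := picking I c (I.roundRobin L U) (L.drop (L.length / 2)) (L.take (L.length / 2))
        { parts := fun q => (I.roundRobin L U q).toFinset, avail := L.toFinset, got := got }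
      run I c (L.drop (L.length / 2)) (s.avail.biUnion s.parts) s.got := by
  match L, hL with
  | a :: b :: L', _ => rw [run]

theorem run_of_notMem (L : List (Fin n)) (U : Finset (Fin m)) (got : Parts n m) {q : Fin n}
    (hq : q ∉ L) : run I c L U got q = got q := by
  induction hN : L.length using Nat.strong_induction_on generalizing L U got with
  | _ N ih =>
    match L, hN with
    | [], _ => rw [run]
    | [a], _ =>
      rw [run]
      exact Function.update_of_ne (by simpa using hq) _ _
    | a :: b :: L', hN =>
      have h2 : 2 ≤ (a :: b :: L').length := by simp
      rw [run_of_two_le h2]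
      dsimp only
      rw [ih _ (by rw [List.length_drop, hN]; rw [hN] at h2; omega) _ _ _
        (fun h => hq (List.mem_of_mem_drop h)) rfl]
      exact picking_got_of_notMem _ (fun h => hq (List.mem_of_mem_take h)) _

/-- Values decrease along a column. If the second entry were missing or worthless, the column would
be worth at most its first item, that is, at most 1. -/
theorem hasTwoPositive_of_one_lt {l : List (Fin n × Fin m)} (hl : l.Pairwise I.PickOrder)
    {a : Fin n} (h : 1 < I.value a (column l a).toFinset) : HasTwoPositive I (column l) a := by
  have hdec : (column l a).Pairwise fun g h => I.val a h ≤ I.val a g := by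
    unfold column
    rw [List.pairwise_map]
    refine (hl.sublist List.filter_sublist).imp_of_mem fun {x y} hx _ hxy => ?_
    have : x.1 = a := by simpa using (List.mem_filter.1 hx).2
    exact this ▸ Prefers.le hxy
  rw [I.value_toFinset a (I.column_nodup hl a)] at h
  match hcol : column l a, hdec, h with
  | [], _, h => norm_num at h
  | [g], _, h =>
    simp only [List.map_cons, List.map_nil, List.sum_cons, List.sum_nil] at h
    linarith [I.le_one a g]
  | g :: x :: t, hdec, h =>
    have hd := List.pairwise_cons.1 hdec
    have hgx := hd.1 x (by simp)
    have hx : 0 < I.val a x := by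
      by_contra hx
      have hsum : (t.map (I.val a)).sum ≤ 0 := by
        refine (List.sum_le_card_nsmul _ 0 fun y hy => ?_).trans_eq (nsmul_zero _)
        obtain ⟨z, hz, rfl⟩ := List.mem_map.1 hy
        exact ((List.pairwise_cons.1 hd.2).1 z hz).trans (not_lt.1 hx)
      simp only [List.map_cons, List.sum_cons] at h
      linarith [I.le_one a g]
    exact ⟨g, x, t, hcol, hx.trans_le hgx, hx⟩

theorem value_le_drop_two_add {x : List (Fin m)} (hx : x.Nodup) (a : Fin n) :
    I.value a x.toFinset ≤ I.value a (x.drop 2).toFinset + 2 := by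
  rw [I.value_toFinset a hx, I.value_toFinset a (hx.sublist (List.drop_sublist _ _))]
  match x with
  | [] => simp
  | [g] =>
    simp only [List.map_cons, List.map_nil, List.sum_cons, List.sum_nil, List.drop_succ_cons,
      List.drop_nil]
    linarith [I.le_one a g]
  | g :: h :: t =>
    simp only [List.map_cons, List.sum_cons, List.drop_succ_cons, List.drop_zero]
    linarith [I.le_one a g, I.le_one a h]

/-- Along a prefix of agents who like their Round-Robin columns well enough, everybody receives
the own column up to two items for each stage among the donors. -/
theorem run_value (hc : I.IsRational c) (L : List (Fin n)) (hL : L.Nodup)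
    (l : List (Fin n × Fin m)) (hl : l.Pairwise I.PickOrder) (N : ℕ)
    (hN : l.map Prod.fst <+: (List.replicate N L).flatten) (got : Parts n m) (k : ℕ)
    (hk : k < L.length)
    (hgood : ∀ j (hj : j < L.length), j ≤ k →
      2 * (depth L.length j : ℝ) + 1 < I.value L[j] (column l L[j]).toFinset) :
    I.value L[k] (column l L[k]).toFinset - 2 * depth L.length k ≤
      I.value L[k] (run I c L (pickedItems l) got L[k]) := by
  -- The list `l` of picks varies in the induction: in the recursive call it is `laterPicks`.
  induction hr : L.length using Nat.strong_induction_on generalizing L l N got k with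
  | _ r ih =>
    subst hr
    rcases lt_or_ge L.length 2 with h2 | h2
    · obtain ⟨a, rfl⟩ := List.length_eq_one_iff.1 (show L.length = 1 by omega)
      obtain rfl : k = 0 := by simpa using hk
      rw [run]
      simp only [List.getElem_cons_zero, Function.update_self]
      have h1 : (column l a).toFinset ⊆ pickedItems l := fun g hg =>
        mem_pickedItems.2 ⟨a, mem_column.1 (List.mem_toFinset.1 hg)⟩
      have h3 : (0 : ℝ) ≤ depth [a].length 0 := Nat.cast_nonneg _
      linarith [I.value_mono a h1]
    · have hne : L ≠ [] := List.ne_nil_of_length_pos (by omega)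
      have hR : I.roundRobin L (pickedItems l) = column l := by
        funext a
        unfold roundRobin
        rw [I.serialPicks_cyclic hl hne hN]
        rfl
      rw [run_of_two_le h2, hR]
      dsimp only
      set mid := L.length / 2 with hmid
      have hsplit : L.take mid ++ L.drop mid = L := List.take_append_drop _ _
      have hinv : StageInv (column l) (L.drop mid) (L.take mid)
          { parts := fun q => (column l q).toFinset, avail := L.toFinset, got := got } := by
        refine ⟨by rw [hsplit], fun _ _ => rfl, fun _ _ => subset_rfl, fun d _ g hg => ?_⟩
        exact List.mem_toFinset.2 (List.mem_of_mem_drop (List.mem_toFinset.1 hg))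
      have hnd : (L.take mid ++ L.drop mid).Nodup := by rwa [hsplit]
      have hdom : (L.take mid ++ L.drop mid).Pairwise (I.RowDominates (column l)) := by
        rw [hsplit]
        exact I.rowDominates_column hl hL hN
      have hlen : (L.take mid).length ≤ (L.drop mid).length + 1 := by
        simp only [List.length_take, List.length_drop]
        omega
      have htwo : ∀ j (hj : j < L.length), j ≤ k → HasTwoPositive I (column l) L[j] := by
        intro j hj hjk
        refine hasTwoPositive_of_one_lt hl ((hgood j hj hjk).trans_le' ?_)
        have : (0 : ℝ) ≤ depth L.length j := Nat.cast_nonneg _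
        linarith
      rcases lt_or_ge k mid with hkm | hkm
      · have hk' : k < (L.take mid).length := by simp; omega
        have hget : (L.take mid)[k] = L[k] := List.getElem_take
        have hnot : L[k] ∉ L.drop mid := fun h =>
          (List.nodup_append.1 hnd).2.2 _ (hget ▸ List.getElem_mem hk') _ h rfl
        rw [run_of_notMem _ _ _ hnot, depth_of_lt hkm]
        have := picking_value hc (L.take mid) hinv hnd (I.column_nodup hl)
          (fun p q => I.column_disjoint hl) hdom hlen k hk' fun j hj hjk => by
            rw [List.getElem_take]
            exact htwo j (by omega) hjk
        rw [hget] at this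
        simpa using this
      · have hpp := picking_parts hc (L.take mid) (by
            refine List.ne_nil_of_length_pos ?_
            simp only [List.length_take]
            omega) hinv hnd (I.column_nodup hl)
          (fun p q => I.column_disjoint hl) hdom hlen fun a ha => by
            obtain ⟨j, hj, rfl⟩ := List.getElem_of_mem ha
            rw [List.getElem_take]
            simp only [List.length_take] at hj
            exact htwo j (by omega) (by omega)
        -- The pooled items are exactly those of the surviving picks, so the induction hypothesis
        -- applies to the next stage.
        have hpool : (picking I c (column l) (L.drop mid) (L.take mid)
            { parts := fun q => (column l q).toFinset, avail := L.toFinset,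
              got := got }).avail.biUnion (picking I c (column l) (L.drop mid) (L.take mid)
            { parts := fun q => (column l q).toFinset, avail := L.toFinset, got := got }).parts =
              pickedItems (laterPicks l L (L.drop mid)) := by
          rw [pickedItems_laterPicks hL hN, hpp.1]
          exact Finset.biUnion_congr rfl fun d hd => hpp.2 d (List.mem_toFinset.1 hd)
        rw [hpool]
        have hlen' : (L.drop mid).length = L.length - mid := List.length_drop
        have hcol : ∀ j (hj : j < (L.drop mid).length),
            I.value (L.drop mid)[j] (column l (L.drop mid)[j]).toFinset ≤
              I.value (L.drop mid)[j]
                (column (laterPicks l L (L.drop mid)) (L.drop mid)[j]).toFinset + 2 := by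
          intro j hj
          rw [column_laterPicks hL hN (List.getElem_mem hj)]
          exact value_le_drop_two_add (I.column_nodup hl _) _
        have hk' : k - mid < (L.drop mid).length := by omega
        have hget : (L.drop mid)[k - mid] = L[k] := by
          rw [List.getElem_drop]
          congr 1
          omega
        have key := ih (L.drop mid).length (by omega) (L.drop mid)
          (hL.sublist (List.drop_sublist _ _)) (laterPicks l L (L.drop mid))
          (I.laterPicks_pairwise hl _ _) _ (laterPicks_fst_prefix hL hN mid)
          (picking I c (column l) (L.drop mid) (L.take mid)
            { parts := fun q => (column l q).toFinset, avail := L.toFinset, got := got }).got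
          (k - mid) hk' (fun j hj hjk => by
            have h1 := hcol j hj
            have h3 := hgood (mid + j) (by omega) (by omega)
            have h4 : (L.drop mid)[j] = L[mid + j] := List.getElem_drop
            rw [depth_of_le h2 (by omega), ← hmid, Nat.add_sub_cancel_left] at h3
            rw [h4] at h1 ⊢
            rw [hlen']
            push_cast at h3
            linarith) rfl
        have h1 := hcol _ hk'
        rw [hget] at h1 key
        rw [hlen'] at key
        rw [depth_of_le h2 hkm, ← hmid]
        push_cast
        linarith

end BoundedProp

/-! ### The guarantee for greedy orders. -/

namespace FairInstance

open BoundedProp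

variable {n m : ℕ} {I : FairInstance n m} {c : Choice n m}

theorem logPos_mono {j k : Fin n} (h : j ≤ k) : logPos j ≤ logPos k := by
  refine Int.ceil_le_ceil (Real.logb_le_logb_of_le (by norm_num) (by positivity) ?_)
  have : (j : ℝ) ≤ (k : ℝ) := by exact_mod_cast h
  linarith

/-- With a greedy arrival order everybody receives their proportional share up to
`2 ⌈log i⌉ + 2`. -/
theorem IsGreedyOrder.le_value {τ : Equiv.Perm (Fin n)} (hτ : I.IsGreedyOrder τ)
    (hc : I.IsRational c) (k : Fin n) :
    I.prop (τ k) - 2 * (logPos k : ℝ) - 2 ≤ I.value (τ k) (I.boundedProp τ c (τ k)) := by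
  rcases lt_or_ge (I.prop (τ k)) (2 * ((logPos k : ℝ) + 1)) with hlt | hge
  · have := I.value_nonneg (τ k) (I.boundedProp τ c (τ k))
    linarith
  · have hL : (List.ofFn τ).Nodup := List.nodup_ofFn.2 τ.injective
    have hlen : (List.ofFn τ).length = n := List.length_ofFn
    set N := (Finset.univ : Finset (Fin m)).card with hNdef
    set l := I.serialPicks (List.replicate N (List.ofFn τ)).flatten Finset.univ with hldef
    have hl : l.Pairwise I.PickOrder := I.serialPicks_pairwise _ _
    have hpre : l.map Prod.fst <+: (List.replicate N (List.ofFn τ)).flatten :=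
      I.serialPicks_fst_prefix _ _
    have hn : 1 ≤ n := by have := k.2; omega
    have hitems : pickedItems l = Finset.univ := by
      refine I.pickedItems_serialPicks _ _ ?_
      simp only [List.length_flatten, List.map_replicate, List.sum_replicate, hlen, smul_eq_mul]
      nlinarith
    have hcol : ∀ j : Fin n, I.prop (τ j) - 1 < I.value (τ j) (column l (τ j)).toFinset := by
      intro j
      have := I.value_column_gt hl hL hpre (p := j) (by rw [hlen]; exact j.2)
      rw [hitems] at this
      simpa [prop] using this
    have hdepth : ∀ j : Fin n, (depth n j : ℝ) ≤ (logPos j : ℝ) := fun j => by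
      exact_mod_cast depth_le_logPos j
    have key := run_value hc (List.ofFn τ) hL l hl N hpre (fun _ => ∅) k (by rw [hlen]; exact k.2)
      fun j hj hjk => by
        have hjn : j < n := by rwa [hlen] at hj
        have hjk' : (⟨j, hjn⟩ : Fin n) ≤ k := hjk
        have hmono : (logPos (⟨j, hjn⟩ : Fin n) : ℝ) ≤ (logPos k : ℝ) := by
          exact_mod_cast logPos_mono hjk'
        -- The threshold at an earlier position is no larger, so agent `τ k` itself meets it and
        -- greediness forces `τ j` to meet it.
        have h1 := hτ ⟨j, hjn⟩ k hjk' (by linarith)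
        have h2 := hcol ⟨j, hjn⟩
        have h3 := hdepth ⟨j, hjn⟩
        simp only [List.getElem_ofFn, hlen]
        simp only at h3
        linarith
    rw [hitems] at key
    simp only [List.getElem_ofFn, hlen, Fin.eta] at key
    have h2 := hcol k
    have h3 := hdepth k
    unfold boundedProp
    linarith

end FairInstance

namespace RAM

/-! ### Program logic -/

/-- Started in `s`, the program `p` halts after at most `T` steps in a state with property `Q`. -/
def Halts (inp : ℕ → ℕ → ℝ) (p : Prog) (s : State) (T : ℕ) (Q : State → Prop) : Prop :=
  ∃ t s', Exec inp p s t s' ∧ t ≤ T ∧ Q s'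

variable {inp : ℕ → ℕ → ℝ}

theorem Halts.of_exec {p : Prog} {s s' : State} {Q : State → Prop} (h : Exec inp p s 1 s')
    (hQ : Q s') : Halts inp p s 1 Q :=
  ⟨1, s', h, le_rfl, hQ⟩

theorem Halts.mono {p : Prog} {s : State} {T T' : ℕ} {Q Q' : State → Prop}
    (h : Halts inp p s T Q) (hT : T ≤ T') (hQ : ∀ s', Q s' → Q' s') : Halts inp p s T' Q' := by
  obtain ⟨t, s', h1, h2, h3⟩ := h
  exact ⟨t, s', h1, h2.trans hT, hQ _ h3⟩

theorem Halts.seq {p q : Prog} {s : State} {T T' : ℕ} {P Q : State → Prop}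
    (h : Halts inp p s T P) (h' : ∀ s', P s' → Halts inp q s' T' Q) :
    Halts inp (.seq p q) s (T + T') Q := by
  obtain ⟨t, s', h1, h2, h3⟩ := h
  obtain ⟨t', s'', h1', h2', h3'⟩ := h' s' h3
  exact ⟨t + t', s'', .seq h1 h1', by omega, h3'⟩

theorem Halts.exec_seq {p q : Prog} {s s' : State} {T : ℕ} {Q : State → Prop}
    (h : Exec inp p s 1 s') (h' : Halts inp q s' T Q) : Halts inp (.seq p q) s (1 + T) Q :=
  (Halts.of_exec (Q := fun x => x = s') h rfl).seq fun _ e => e ▸ h'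

theorem Halts.ifI {x y : ℕ} {p q : Prog} {s : State} {T : ℕ} {Q : State → Prop}
    (h1 : s.idx x < s.idx y → Halts inp p s T Q) (h2 : s.idx y ≤ s.idx x → Halts inp q s T Q) :
    Halts inp (.ifI x y p q) s (T + 1) Q := by
  rcases lt_or_ge (s.idx x) (s.idx y) with h | h
  · obtain ⟨t, s', e, ht, hQ⟩ := h1 h
    exact ⟨t + 1, s', .ifI_lt h e, by omega, hQ⟩
  · obtain ⟨t, s', e, ht, hQ⟩ := h2 h
    exact ⟨t + 1, s', .ifI_ge h e, by omega, hQ⟩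

theorem Halts.ifV {x y : ℕ} {p q : Prog} {s : State} {T : ℕ} {Q : State → Prop}
    (h1 : s.val x < s.val y → Halts inp p s T Q) (h2 : s.val y ≤ s.val x → Halts inp q s T Q) :
    Halts inp (.ifV x y p q) s (T + 1) Q := by
  rcases lt_or_ge (s.val x) (s.val y) with h | h
  · obtain ⟨t, s', e, ht, hQ⟩ := h1 h
    exact ⟨t + 1, s', .ifV_lt h e, by omega, hQ⟩
  · obtain ⟨t, s', e, ht, hQ⟩ := h2 h
    exact ⟨t + 1, s', .ifV_ge h e, by omega, hQ⟩

/-- A loop whose register `x` counts from `0` to the bound `N` in register `y`. -/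
theorem Halts.loop {x y N T : ℕ} {p : Prog} (Inv : ℕ → State → Prop)
    (hreg : ∀ k s, Inv k s → s.idx x = k ∧ s.idx y = N)
    (hbody : ∀ k s, k < N → Inv k s → Halts inp p s T (Inv (k + 1))) (s : State) (h0 : Inv 0 s) :
    Halts inp (.whileI x y p) s (N * (T + 1) + 1) (Inv N) := by
  -- Induction on the number `d` of iterations still to come.
  suffices H : ∀ d k s, k + d = N → Inv k s →
      Halts inp (.whileI x y p) s (d * (T + 1) + 1) (Inv N) from H N 0 s (by omega) h0
  intro d
  induction d with
  | zero =>
    intro k s hk hI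
    obtain rfl : k = N := by omega
    have := hreg k s hI
    exact ⟨1, s, .while_ge (by omega), by omega, hI⟩
  | succ d ih =>
    intro k s hk hI
    have hr := hreg k s hI
    obtain ⟨t, s', h1, h2, h3⟩ := hbody k s (by omega) hI
    obtain ⟨t', s'', h1', h2', h3'⟩ := ih (k + 1) s' (by omega) h3
    exact ⟨t + t' + 1, s'', .while_lt (by omega) h1 h1', by
      rw [Nat.succ_mul]
      omega, h3'⟩

/-! ### Sorting the agents by their total values -/

/-- Value register `d` becomes the sum of the row of the input table given by index register `a`.
The number of columns is in register `1` and the constant `1` in register `2`. -/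
def rowSum (d a : ℕ) : Prog :=
  .seq (.setV d 0) (.seq (.setI 5 0)
    (.whileI 5 1 (.seq (.input 2 a 5) (.seq (.addV d d 2) (.addI 5 5 2)))))

/-- Value register 2 and index register 5 are scratch space, hence the conditions on `d` and `a`.
Each item costs three instructions and a test. -/
theorem rowSum_halts {d a : ℕ} (hd : d ≠ 2) (ha : a ≠ 5) (s : State) (hone : s.idx 2 = 1) :
    Halts inp (rowSum d a) s (4 * s.idx 1 + 3) fun s' =>
      (∀ r, r ≠ 5 → s'.idx r = s.idx r) ∧ s'.mem = s.mem ∧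
      (∀ r, r ≠ d → r ≠ 2 → s'.val r = s.val r) ∧
      s'.val d = ∑ g ∈ Finset.range (s.idx 1), inp (s.idx a) g := by
  have hloop := Halts.loop (inp := inp) (x := 5) (y := 1) (N := s.idx 1) (T := 3)
    (p := .seq (.input 2 a 5) (.seq (.addV d d 2) (.addI 5 5 2)))
    (fun k s' => s'.idx 5 = k ∧ (∀ r, r ≠ 5 → s'.idx r = s.idx r) ∧ s'.mem = s.mem ∧
      (∀ r, r ≠ d → r ≠ 2 → s'.val r = s.val r) ∧
      s'.val d = ∑ g ∈ Finset.range k, inp (s.idx a) g)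
    (fun k s' h => ⟨h.1, h.2.1 1 (by norm_num)⟩)
    (fun k s' _ h => by
      obtain ⟨h1, h2, h3, h4, h5⟩ := h
      refine Halts.exec_seq (.input _ _ _ _) (Halts.exec_seq (.addV _ _ _ _)
        (Halts.of_exec (.addI _ _ _ _) ⟨?_, fun r hr => ?_, h3, fun r hr hr2 => ?_, ?_⟩))
      · simp [h1, h2 2 (by norm_num), hone]
      · simp [hr, h2 r hr]
      · simp [hr, hr2, h4 r hr hr2]
      · simp [Function.update_of_ne hd, h5, h1, h2 a ha, Finset.sum_range_succ])
  refine (Halts.exec_seq (.setV _ _ _) (Halts.exec_seq (.setI _ _ _) (hloop _ ?_))).mono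
    (by omega) fun s' h => h.2
  refine ⟨by simp, fun r hr => by simp [hr], rfl, fun r hr _ => by simp [hr], by simp⟩

/-- `b` precedes `a` in the order of decreasing row sums `S`, ties being broken by the index. -/
def Beats (S : ℕ → ℝ) (b a : ℕ) : Prop := S a < S b ∨ S b = S a ∧ b < a

open Classical in
/-- The number of indices below `n` that precede `a`. -/
def rank (S : ℕ → ℝ) (n a : ℕ) : ℕ := ((Finset.range n).filter fun b => Beats S b a).card

theorem Beats.trans {S : ℕ → ℝ} {a b c : ℕ} (h : Beats S a b) (h' : Beats S b c) :
    Beats S a c := by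
  rcases h with h | h <;> rcases h' with h' | h'
  · exact Or.inl (h'.trans h)
  · exact Or.inl (h'.1 ▸ h)
  · exact Or.inl (h.1 ▸ h')
  · exact Or.inr ⟨h.1.trans h'.1, h.2.trans h'.2⟩

theorem not_beats_self (S : ℕ → ℝ) (a : ℕ) : ¬ Beats S a a := by
  simp [Beats]

theorem rank_lt {S : ℕ → ℝ} {n a : ℕ} (ha : a < n) : rank S n a < n := by
  classical
  have : rank S n a < (Finset.range n).card := by
    refine Finset.card_lt_card (Finset.ssubset_iff_subset_ne.2 ⟨Finset.filter_subset _ _, ?_⟩)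
    intro e
    have := Finset.mem_range.2 ha
    rw [← e, Finset.mem_filter] at this
    exact not_beats_self S a this.2
  simpa using this

/-- By transitivity, whatever precedes `b` precedes `a`, and `b` itself is an additional
predecessor. -/
theorem rank_lt_rank {S : ℕ → ℝ} {n a b : ℕ} (hb : b < n) (h : Beats S b a) :
    rank S n b < rank S n a := by
  classical
  refine Finset.card_lt_card (Finset.ssubset_iff_subset_ne.2 ⟨fun x hx => ?_, fun e => ?_⟩)
  · rw [Finset.mem_filter] at hx ⊢
    exact ⟨hx.1, hx.2.trans h⟩
  · have : b ∈ (Finset.range n).filter fun x => Beats S x a :=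
      Finset.mem_filter.2 ⟨Finset.mem_range.2 hb, h⟩
    rw [← e, Finset.mem_filter] at this
    exact not_beats_self S b this.2

theorem rank_injOn {S : ℕ → ℝ} {n a b : ℕ} (ha : a < n) (hb : b < n)
    (h : rank S n a = rank S n b) : a = b := by
  by_contra hne
  have : Beats S a b ∨ Beats S b a := by
    rcases lt_trichotomy (S a) (S b) with h | h | h
    · exact Or.inr (Or.inl h)
    · rcases Nat.lt_or_gt_of_ne hne with h' | h'
      · exact Or.inl (Or.inr ⟨h, h'⟩)
      · exact Or.inr (Or.inr ⟨h.symm, h'⟩)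
    · exact Or.inl (Or.inl h)
  rcases this with h' | h'
  · exact absurd h (rank_lt_rank ha h').ne
  · exact absurd h (rank_lt_rank hb h').ne'

theorem rank_succ (S : ℕ → ℝ) (k a : ℕ) [Decidable (Beats S k a)] :
    rank S (k + 1) a = rank S k a + if Beats S k a then 1 else 0 := by
  classical
  unfold rank
  rw [Finset.range_add_one, Finset.filter_insert]
  split_ifs
  · rw [Finset.card_insert_of_notMem (by simp)]
  · rfl

/-- Compare the agents in the registers `3` and `4`, whose row sums are in the value registers `0`
and `1`; register `6` is increased by one if the latter precedes the former. -/
def compareStep : Prog :=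
  .ifV 0 1 (.addI 6 6 2) (.ifV 1 0 (.setI 7 0) (.ifI 4 3 (.addI 6 6 2) (.setI 7 0)))

-- Equality of values is detected by the failure of both strict comparisons. Writing to the
-- otherwise unused register 7 serves as an idle instruction.
open Classical in
theorem compareStep_halts {S : ℕ → ℝ} {a b : ℕ} (s : State) (hone : s.idx 2 = 1)
    (h3 : s.idx 3 = a) (h4 : s.idx 4 = b) (h0 : s.val 0 = S a) (h1 : s.val 1 = S b) :
    Halts inp compareStep s 4 fun s' =>
      (∀ r, r ≠ 6 → r ≠ 7 → s'.idx r = s.idx r) ∧ s'.mem = s.mem ∧ s'.val = s.val ∧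
      s'.idx 6 = s.idx 6 + if Beats S b a then 1 else 0 := by
  have hyes : Beats S b a → Halts inp (.addI 6 6 2) s 1 fun s' =>
      (∀ r, r ≠ 6 → r ≠ 7 → s'.idx r = s.idx r) ∧ s'.mem = s.mem ∧ s'.val = s.val ∧
      s'.idx 6 = s.idx 6 + if Beats S b a then 1 else 0 := fun hB =>
    Halts.of_exec (.addI _ _ _ _) ⟨fun r hr _ => by simp [hr], rfl, rfl, by simp [hB, hone]⟩
  have hno : ¬ Beats S b a → Halts inp (.setI 7 0) s 1 fun s' =>
      (∀ r, r ≠ 6 → r ≠ 7 → s'.idx r = s.idx r) ∧ s'.mem = s.mem ∧ s'.val = s.val ∧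
      s'.idx 6 = s.idx 6 + if Beats S b a then 1 else 0 := fun hB =>
    Halts.of_exec (.setI _ _ _) ⟨fun r _ hr => by simp [hr], rfl, rfl, by simp [hB]⟩
  unfold compareStep
  refine Halts.ifV (T := 3) (fun h => ?_) fun h => Halts.ifV (T := 2) (fun h' => ?_) fun h' =>
    Halts.ifI (T := 1) (fun h'' => ?_) fun h'' => ?_
  · rw [h0, h1] at h
    exact (hyes (Or.inl h)).mono (by omega) fun _ hs => hs
  · rw [h0, h1] at h'
    refine (hno ?_).mono (by omega) fun _ hs => hs
    rintro (hB | hB)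
    · exact lt_asymm h' hB
    · exact h'.ne hB.1
  · rw [h0, h1] at h h'
    rw [h3, h4] at h''
    exact hyes (Or.inr ⟨le_antisymm h h', h''⟩)
  · rw [h0, h1] at h
    rw [h3, h4] at h''
    refine hno ?_
    rintro (hB | hB)
    · exact absurd hB (not_lt.2 h)
    · omega

/-- Register `6` becomes the rank of the agent in register `3`, whose row sum is in the value
register `0`. -/
def computeRank : Prog :=
  .seq (.setI 6 0) (.seq (.setI 4 0)
    (.whileI 4 0 (.seq (rowSum 1 4) (.seq compareStep (.addI 4 4 2)))))

theorem computeRank_halts {S : ℕ → ℝ} {n m a : ℕ}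
    (hS : ∀ b, S b = ∑ g ∈ Finset.range m, inp b g) (s : State) (hn : s.idx 0 = n)
    (hm : s.idx 1 = m) (hone : s.idx 2 = 1) (h3 : s.idx 3 = a) (h0 : s.val 0 = S a) :
    Halts inp computeRank s (n * (4 * m + 9) + 3) fun s' =>
      (∀ r, r < 4 → s'.idx r = s.idx r) ∧ s'.mem = s.mem ∧ s'.idx 6 = rank S n a := by
  classical
  have hloop := Halts.loop (inp := inp) (x := 4) (y := 0) (N := n) (T := 4 * m + 8)
    (p := .seq (rowSum 1 4) (.seq compareStep (.addI 4 4 2)))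
    (fun k s' => s'.idx 4 = k ∧ (∀ r, r < 4 → s'.idx r = s.idx r) ∧ s'.mem = s.mem ∧
      s'.val 0 = s.val 0 ∧ s'.idx 6 = rank S k a)
    (fun k s' h => ⟨h.1, by rw [h.2.1 0 (by norm_num), hn]⟩)
    (fun k s' _ h => by
      obtain ⟨e4, eidx, emem, e0, e6⟩ := h
      have e1 : s'.idx 1 = m := by rw [eidx 1 (by norm_num), hm]
      have e2 : s'.idx 2 = 1 := by rw [eidx 2 (by norm_num), hone]
      refine Halts.mono (T := 4 * m + 3 + (4 + 1)) (Halts.seq (by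
        have := rowSum_halts (inp := inp) (d := 1) (a := 4) (by norm_num) (by norm_num) s' e2
        rwa [e1] at this) fun u hu => ?_) (by omega) fun _ hs => hs
      obtain ⟨uidx, umem, uval, u1⟩ := hu
      refine Halts.seq (compareStep_halts (S := S) (a := a) (b := k) u
        (by rw [uidx 2 (by norm_num), e2])
        (by rw [uidx 3 (by norm_num), eidx 3 (by norm_num), h3])
        (by rw [uidx 4 (by norm_num), e4])
        (by rw [uval 0 (by norm_num) (by norm_num), e0, h0]) (by rw [u1, e4, hS]))
        fun w hw => ?_
      obtain ⟨widx, wmem, wval, w6⟩ := hw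
      refine Halts.of_exec (.addI _ _ _ _) ⟨?_, fun r hr => ?_, ?_, ?_, ?_⟩
      · simp [widx 4 (by norm_num) (by norm_num), widx 2 (by norm_num) (by norm_num),
          uidx 4 (by norm_num), uidx 2 (by norm_num), e4, e2]
      · simp [hr.ne, widx r (by omega) (by omega), uidx r (by omega), eidx r hr]
      · exact wmem.trans (umem.trans emem)
      · simp [wval, uval 0 (by norm_num) (by norm_num), e0]
      · simp [w6, uidx 6 (by norm_num), e6, rank_succ])
  refine (Halts.exec_seq (.setI _ _ _) (Halts.exec_seq (.setI _ _ _) (hloop _ ?_))).mono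
    (le_of_eq (by ring)) fun s' h => ⟨h.2.1, h.2.2.1, h.2.2.2.2⟩
  refine ⟨by simp, fun r hr => ?_, rfl, rfl, by simp [rank]⟩
  have h6 : r ≠ 6 := by omega
  simp [hr.ne, h6]

/-- Sort the agents by decreasing row sums: each agent is stored at its rank. -/
def sortAgents : Prog :=
  .seq (.setI 2 1) (.whileI 3 0 (.seq (rowSum 0 3) (.seq computeRank
    (.seq (.storeI 6 3) (.addI 3 3 2)))))

theorem sortAgents_halts {S : ℕ → ℝ} {n m : ℕ} (hS : ∀ b, S b = ∑ g ∈ Finset.range m, inp b g) :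
    Halts inp sortAgents (start n m) (n * ((n + 1) * (4 * m + 9)) + 2) fun s' =>
      ∀ a, a < n → s'.mem (rank S n a) = a := by
  have hloop := Halts.loop (inp := inp) (x := 3) (y := 0) (N := n)
    (T := (4 * m + 3) + ((n * (4 * m + 9) + 3) + 2))
    (p := .seq (rowSum 0 3) (.seq computeRank (.seq (.storeI 6 3) (.addI 3 3 2))))
    (fun k s' => s'.idx 3 = k ∧ s'.idx 0 = n ∧ s'.idx 1 = m ∧ s'.idx 2 = 1 ∧
      ∀ a, a < k → s'.mem (rank S n a) = a)
    (fun k s' h => ⟨h.1, h.2.1⟩)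
    (fun k s' hk h => by
      obtain ⟨e3, e0, e1, e2, emem⟩ := h
      refine Halts.seq (by
        have := rowSum_halts (inp := inp) (d := 0) (a := 3) (by norm_num) (by norm_num) s' e2
        rwa [e1] at this) fun u hu => ?_
      obtain ⟨uidx, umem, uval, u0⟩ := hu
      have u3 : u.idx 3 = k := by rw [uidx 3 (by norm_num), e3]
      have u2 : u.idx 2 = 1 := by rw [uidx 2 (by norm_num), e2]
      refine Halts.seq (computeRank_halts hS u (by rw [uidx 0 (by norm_num), e0])
        (by rw [uidx 1 (by norm_num), e1]) u2 u3 (by rw [u0, e3, hS])) fun w hw => ?_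
      obtain ⟨widx, wmem, w6⟩ := hw
      have w3 : w.idx 3 = k := by rw [widx 3 (by norm_num), u3]
      have w2 : w.idx 2 = 1 := by rw [widx 2 (by norm_num), u2]
      refine Halts.exec_seq (.storeI _ _ _) (Halts.of_exec (.addI _ _ _ _) ⟨?_, ?_, ?_, ?_, ?_⟩)
      · simp [w3, w2]
      · simp [widx 0 (by norm_num), uidx 0 (by norm_num), e0]
      · simp [widx 1 (by norm_num), uidx 1 (by norm_num), e1]
      · simp [w2]
      · intro a ha
        simp only [w6, w3, wmem, umem]
        rcases Nat.lt_succ_iff_lt_or_eq.1 ha with h | rfl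
        · rw [Function.update_of_ne, emem a h]
          -- Ranks are distinct, so no earlier entry is overwritten.
          exact fun e => h.ne (rank_injOn (h.trans hk) hk e)
        · rw [Function.update_self])
  refine (Halts.exec_seq (.setI _ _ _) (hloop _ ?_)).mono ?_ fun s' h => h.2.2.2.2
  · simp [start]
  · apply le_of_eq
    ring

theorem sum_table {n m : ℕ} (I : FairInstance n m) (a : Fin n) :
    ∑ g ∈ Finset.range m, table I a g = I.value a Finset.univ := by
  rw [Finset.sum_range, FairInstance.value]
  exact Finset.sum_congr rfl fun g _ => by simp [table]

/-- The program `sortAgents` computes an arrival order of decreasing proportional shares. -/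
theorem sortAgents_computesOrder {n m : ℕ} (I : FairInstance n m) :
    ∃ τ : Equiv.Perm (Fin n),
      ComputesOrder sortAgents I τ (n * ((n + 1) * (4 * m + 9)) + 2) ∧
      ∀ k l : Fin n, k ≤ l → I.prop (τ l) ≤ I.prop (τ k) := by
  set S : ℕ → ℝ := fun b => ∑ g ∈ Finset.range m, table I b g with hS
  let ρ : Fin n → Fin n := fun a => ⟨rank S n a, rank_lt a.2⟩
  have hρ : Function.Injective ρ := fun a b h =>
    Fin.ext (rank_injOn a.2 b.2 (congrArg Fin.val h))
  let e : Equiv.Perm (Fin n) := Equiv.ofBijective ρ (Finite.injective_iff_bijective.1 hρ)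
  have he : ∀ k, rank S n (e.symm k) = k := fun k =>
    congrArg Fin.val (e.apply_symm_apply k)
  -- The memory lists agents by rank, so the arrival order is the inverse of the rank map.
  refine ⟨e.symm, ?_, fun k l hkl => ?_⟩
  · obtain ⟨t, s', h1, h2, h3⟩ :=
      sortAgents_halts (inp := table I) (S := S) (n := n) (m := m) fun b => rfl
    refine ⟨t, s', h1, h2, fun k => ?_⟩
    have := h3 (e.symm k) (e.symm k).2
    rwa [he] at this
  · unfold FairInstance.prop
    refine div_le_div_of_nonneg_right ?_ (Nat.cast_nonneg n)
    by_contra hlt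
    rw [← sum_table, ← sum_table, not_le] at hlt
    have := rank_lt_rank (n := n) (e.symm l).2 (Or.inl hlt : Beats S (e.symm l) (e.symm k))
    rw [he, he] at this
    exact absurd hkl (not_le.2 this)

end RAM

end

theorem theorem8 :
    ∃ (prog : RAM.Prog) (bound : Polynomial ℕ),
      ∀ (n m : ℕ) (I : FairInstance n m),
        ∃ τ : Equiv.Perm (Fin n),
          RAM.ComputesOrder prog I τ (bound.eval (n + m)) ∧
          I.IsGreedyOrder τ ∧
          ∀ c : Choice n m, I.IsRational c →
            ∀ k : Fin n,
              I.prop (τ k) - 2 * (FairInstance.logPos k : ℝ) - 2 ≤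
                I.value (τ k) (I.boundedProp τ c (τ k)) := by
  refine ⟨RAM.sortAgents,
    -- This is the step count with both `n` and `m` replaced by `n + m`.
    Polynomial.X * ((Polynomial.X + 1) * (4 * Polynomial.X + 9)) + 2, fun n m I => ?_⟩
  obtain ⟨τ, ⟨t, s, h1, h2, h3⟩, hanti⟩ := RAM.sortAgents_computesOrder I
  have hgreedy : I.IsGreedyOrder τ := fun k l hkl h => h.trans (hanti k l hkl)
  refine ⟨τ, ⟨t, s, h1, h2.trans ?_, h3⟩, hgreedy, fun c hc k => hgreedy.le_value hc k⟩
  simp only [Polynomial.eval_add, Polynomial.eval_mul, Polynomial.eval_X, Polynomial.eval_one,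
    Polynomial.eval_ofNat]
  gcongr <;> omega
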